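/- **Setting.** Let $\mathcal N=\{1,\dots,n\}$ and let $\{(Y_{0,t},Y_{1,t},\dots,Y_{n,t},Y_{n+1,t})\}_{t\ge1}$ be i.i.d. copies of a finite-alphabet random vector $(Y_0,\mathbf Y_{\mathcal N},Y_{n+1})$, where $Y_0$ is a hidden source, $Y_i$ is observed by encoder $i\in\mathcal N$, and $Y_{n+1}$ is side information observed only by the decoder. For $j=1,\dots,J$ the decoder produces a $\mathcal V_j$-valued reproduction from every nonempty set $\mathcal K\subseteq\mathcal N$ of messages; its quality is measured by a function $d_{\mathcal K,j}:\prod_{i=0}^{n+1}\mathcal Y_i\times\mathcal V_j\to[0,\infty)$ (which may, but need not, depend on $\mathcal K$; measures $d_j(Y_0,\mathbf Y_{\mathcal K},Y_{n+1},\cdot)$ are included). Logarithms are to base 2, and information quantities are in bits. **Achievable vectors.** A real vector $(\mathbf R,\mathbf D)=\big((R_i)_{i\in\mathcal N},(D_{k,j})_{1\le k\le n,\,1\le j\le J}\big)$ is achievable if for some $l\ge1$ there are encoders $f_i:\mathcal Y_i^l\to\{1,\dots,M_i\}$ and decoders $g_{\mathcal K}^j:\mathcal Y_{n+1}^l\times\prod_{i\in\mathcal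 K}\{1,\dots,M_i\}\to\mathcal V_j^l$, for all nonempty $\mathcal K\subseteq\mathcal N$, with $R_i\ge\frac1l\log M_i$ for all $i$ and, writing $V_{\mathcal K,j}^l$ for the output of $g^j_{\mathcal K}$, $$D_{k,j}\ \ge\ \max_{|\mathcal K|=k}\mathbf E\Big[\frac1l\sum_{t=1}^l d_{\mathcal K,j}(Y_{0,t},\mathbf Y_{\mathcal N,t},Y_{n+1,t},V_{\mathcal K,j,t})\Big]\quad\text{for all }k,j.$$ Let $\mathcal{RD}_\star$ be the set of achievable vectors. **Outer region.** Let $\psi$ be the set of finite-alphabet $Z$, jointly distributed with the source, such that $Y_1,\dots,Y_n$ are conditionally independent given $(Z,Y_{n+1})$. Let $\Gamma_o$ be the set of finite-alphabet $\gamma=(U_1,\dots,U_n,(V_{\mathcal K,j})_{\emptyset\ne\mathcal K\subseteq\mathcal N,\,1\le j\le J},W,T)$, with $V_{\mathcal K,j}$ taking values in $\mathcal V_j$, such that 1. $(W,T)$ is independent of $(Y_0,\mathbf Y_{\mathcal N},Y_{n+1})$; 2. $U_i\leftrightarrow(Y_i,W,T)\leftrightarrow(Y_0,\mathbf Y_{\{i\}^c},Y_{n+1},\mathbf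 U_{\{i\}^c})$ is a Markov chain for all $i\in\mathcal N$; 3. $(Y_0,\mathbf Y_{\mathcal N},W)\leftrightarrow(\mathbf U_{\mathcal N},Y_{n+1},T)\leftrightarrow(V_{\mathcal K,j})_{\mathcal K,j}$ is a Markov chain; 4. $(Y_0,\mathbf Y_{\mathcal N},W,\mathbf U_{\mathcal K^c})\leftrightarrow(\mathbf U_{\mathcal K},Y_{n+1},T)\leftrightarrow(V_{\mathcal K,j})_{j}$ is a Markov chain for every nonempty $\mathcal K\subseteq\mathcal N$. Couple $Z\in\psi$ and $\gamma\in\Gamma_o$ so that $Z\leftrightarrow(Y_0,\mathbf Y_{\mathcal N},Y_{n+1})\leftrightarrow\gamma$ is a Markov chain. Let $\mathcal{RD}_o(Z,\gamma)$ be the set of $(\mathbf R,\mathbf D)$ with $$\sum_{i\in\mathcal K}R_i\ \ge\ \max\Big(I(Z;\mathbf U_{\mathcal K}|Y_{n+1},T),\,I(Z;\mathbf U_{\mathcal K}|\mathbf U_{\mathcal K^c},Y_{n+1},T)\Big)+\sum_{i\in\mathcal K}I(Y_i;U_i|Z,Y_{n+1},W,T)\quad\text{for all }\mathcal K\subseteq\mathcal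 N,$$ $$D_{k,j}\ \ge\ \max_{|\mathcal K|=k}\mathbf E\big[d_{\mathcal K,j}(Y_0,\mathbf Y_{\mathcal N},Y_{n+1},V_{\mathcal K,j})\big]\quad\text{for all }k,j,$$ and let $\mathcal{RD}_o=\bigcap_{Z\in\psi}\bigcup_{\gamma\in\Gamma_o}\mathcal{RD}_o(Z,\gamma)$. **Theorem.** $\mathcal{RD}_\star\subseteq\mathcal{RD}_o$. Moreover, this bound is at least as strong as that of Wagner and Anantharam: if $n\ge1$ and $(\mathbf R,\mathbf D)\in\mathcal{RD}_o$, then for every $Z\in\psi$ there are finite-alphabet $(U_1,\dots,U_n,V_1,\dots,V_J,W,T)$, with $V_j$ taking values in $\mathcal V_j$, satisfying conditions 1, 2, and 3 with $(V_1,\dots,V_J)$ in place of $(V_{\mathcal K,j})_{\mathcal K,j}$, joined to $Z$ by the Markov coupling, such that $\sum_{i\in\mathcal K}R_i\ge I(Z;\mathbf U_{\mathcal K}|\mathbf U_{\mathcal K^c},Y_{n+1},T)+\sum_{i\in\mathcal K}I(Y_i;U_i|Z,Y_{n+1},W,T)$ for all $\mathcal K\subseteq\mathcal N$ and $D_{n,j}\ge\mathbf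 E[d_{\mathcal N,j}(Y_0,\mathbf Y_{\mathcal N},Y_{n+1},V_j)]$ for all $j$. -/

import Mathlib

open scoped NNReal

namespace MultiterminalSC

noncomputable section

/-! ### Finite probability spaces

A finite probability space is a finite type `Ω` with a weight `p ∈ stdSimplex ℝ Ω`; a random variable
is a function on `Ω`, which then takes only finitely many values. -/

section Probability

variable {Ω : Type*} [Fintype Ω] {α β γ : Type*}

open Classical in
/-- The probability `P(X = x)`. -/
def law (p : Ω → ℝ) (X : Ω → α) (x : α) : ℝ :=
  ∑ ω with X ω = x, p ω

/-- The entropy in bits, `H(X) = E[-log₂ P_X(X)]`. -/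
def entropy (p : Ω → ℝ) (X : Ω → α) : ℝ :=
  ∑ ω, p ω * -Real.logb 2 (law p X (X ω))

/-- The conditional entropy in bits, `H(X | Y) = H(X, Y) - H(Y)`. -/
def condEntropy (p : Ω → ℝ) (X : Ω → α) (Y : Ω → β) : ℝ :=
  entropy p (fun ω => (X ω, Y ω)) - entropy p Y

/-- The conditional mutual information in bits, `I(X; Y | C) = H(X | C) - H(X | Y, C)`. -/
def condMutualInfo (p : Ω → ℝ) (X : Ω → α) (Y : Ω → β) (C : Ω → γ) : ℝ :=
  condEntropy p X C - condEntropy p X (fun ω => (Y ω, C ω))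

/-- Independence of `X` and `Y`. -/
def Indep (p : Ω → ℝ) (X : Ω → α) (Y : Ω → β) : Prop :=
  ∀ x y, law p (fun ω => (X ω, Y ω)) (x, y) = law p X x * law p Y y

/-- `X ↔ C ↔ Y` is a Markov chain: `P(x, c, y) P(c) = P(x, c) P(c, y)`. -/
def Markov (p : Ω → ℝ) (X : Ω → α) (C : Ω → γ) (Y : Ω → β) : Prop :=
  ∀ x c y, law p (fun ω => (X ω, C ω, Y ω)) (x, c, y) * law p C c =
    law p (fun ω => (X ω, C ω)) (x, c) * law p (fun ω => (C ω, Y ω)) (c, y)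

/-- The members of a finite family `Y` are conditionally independent given `C`:
`P(y₁, …, yₙ | c) = ∏ᵢ P(yᵢ | c)` whenever `P(c) ≠ 0`. -/
def CondIndepFamily {ι : Type*} [Fintype ι] {𝒴 : ι → Type*} (p : Ω → ℝ)
    (Y : ∀ i, Ω → 𝒴 i) (C : Ω → γ) : Prop :=
  ∀ c, law p C c ≠ 0 → ∀ y : ∀ i, 𝒴 i,
    law p (fun ω => ((fun i => Y i ω), C ω)) (y, c) / law p C c =
      ∏ i, law p (fun ω => (Y i ω, C ω)) (y i, c) / law p C c

end Probability

/-! ### The source coding problem -/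

/-- A source symbol `(Y₀, (Y₁, …, Yₙ), Yₙ₊₁)`: hidden source, encoded sources, side information. -/
abbrev Sym {n : ℕ} (A : Type) (Y : Fin n → Type) (S : Type) : Type :=
  A × (∀ i, Y i) × S

/-- The nonempty sets of messages. -/
abbrev Msgs (n : ℕ) : Type := {K : Finset (Fin n) // K.Nonempty}

/-- Rate-distortion vectors `(R, D)`. The entry `D k j` is the distortion constraint on the `j`-th
reproduction from any `k + 1` messages, as `k : Fin n` runs through `0, …, n - 1`. -/
abbrev RDVec (n J : ℕ) : Type := (Fin n → ℝ) × (Fin n → Fin J → ℝ)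

section Region

variable {n J : ℕ} {A S : Type} {Y : Fin n → Type} {V : Fin J → Type*}
  [Fintype A] [Fintype S] [∀ i, Fintype (Y i)]

/-- The expected per-letter distortion `E[(1/l) ∑ₜ d(X_t, V_t)]` for a block `X^l` of `l` independent
symbols with law `q`, where the reproduction `V^l` is the function `v` of the block. -/
def blockDistortion {𝒱 : Type*} (q : Sym A Y S → ℝ) (l : ℕ) (d : Sym A Y S → 𝒱 → ℝ≥0)
    (v : (Fin l → Sym A Y S) → Fin l → 𝒱) : ℝ :=
  ∑ x : Fin l → Sym A Y S, (∏ t, q (x t)) * ((1 / (l : ℝ)) * ∑ t, (d (x t) (v x t) : ℝ))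

/-- The set of achievable rate-distortion vectors. The distortion of the `j`-th reproduction from the
messages in `K` is measured by `d K j`. -/
def achievableRegion (q : Sym A Y S → ℝ)
    (d : Msgs n → (j : Fin J) → Sym A Y S → V j → ℝ≥0) : Set (RDVec n J) :=
  {RD | ∃ l : ℕ, 0 < l ∧ ∃ (M : Fin n → ℕ)
      (f : (i : Fin n) → (Fin l → Y i) → Fin (M i))
      (g : (K : Msgs n) → (j : Fin J) → (Fin l → S) → ((i : K.1) → Fin (M i)) → Fin l → V j),
      (∀ i, (1 / (l : ℝ)) * Real.logb 2 (M i) ≤ RD.1 i) ∧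
      ∀ (k : Fin n) (j : Fin J) (K : Msgs n), K.1.card = k + 1 →
        blockDistortion q l (d K j)
          (fun x => g K j (fun t => (x t).2.2) (fun i => f i (fun t => (x t).2.1 i)))
          ≤ RD.2 k j}

/-- `r` is the joint law of `(Z, Y₀, …, Yₙ₊₁)`, where `(Y₀, …, Yₙ₊₁)` has law `q` and `Y₁, …, Yₙ` are
conditionally independent given `(Z, Yₙ₊₁)`. -/
structure IsPsi {ζ : Type} [Fintype ζ] (q : Sym A Y S → ℝ) (r : ζ × Sym A Y S → ℝ) : Prop where
  mem_simplex : r ∈ stdSimplex ℝ (ζ × Sym A Y S)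
  marginal : ∀ x, ∑ z, r (z, x) = q x
  condIndep : CondIndepFamily r (fun i zx => zx.2.2.1 i) (fun zx => (zx.1, zx.2.2.2))

/-- Auxiliary random variables `γ = (U₁, …, Uₙ, V, W, T)` on a finite probability space, together with
the source symbol `X = (Y₀, …, Yₙ₊₁)` and with `Z`, where `(Z, X)` has law `r` and `Z`, `γ` are joined
by the Markov coupling. All reproductions together form the single variable `V`. -/
structure Aux {ζ : Type} [Fintype ζ] (r : ζ × Sym A Y S → ℝ) (𝒱 : Type*) where
  Ω : Type
  [fintype : Fintype Ω]
  p : Ω → ℝ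
  mem_simplex : p ∈ stdSimplex ℝ Ω
  Z : Ω → ζ
  X : Ω → Sym A Y S
  {UAlph : Fin n → Type}
  {WAlph : Type}
  {TAlph : Type}
  U : (i : Fin n) → Ω → UAlph i
  V : Ω → 𝒱
  W : Ω → WAlph
  T : Ω → TAlph
  /-- `(Z, X)` has the given law -/
  law_eq : ∀ zx, law p (fun ω => (Z ω, X ω)) zx = r zx
  /-- `(W, T)` is independent of `(Y₀, …, Yₙ₊₁)` -/
  indep : Indep p (fun ω => (W ω, T ω)) X
  /-- `Uᵢ ↔ (Yᵢ, W, T) ↔ (Y₀, Y_{iᶜ}, Yₙ₊₁, U_{iᶜ})` -/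
  markov_U : ∀ i, Markov p (U i) (fun ω => ((X ω).2.1 i, W ω, T ω))
    (fun ω => ((X ω).1, (fun k : {k // k ≠ i} => (X ω).2.1 k), (X ω).2.2,
      (fun k : {k // k ≠ i} => U k ω)))
  /-- `(Y₀, Y_N, W) ↔ (U_N, Yₙ₊₁, T) ↔ V` -/
  markov_V : Markov p (fun ω => ((X ω).1, (X ω).2.1, W ω))
    (fun ω => ((fun i => U i ω), (X ω).2.2, T ω)) V
  /-- the Markov coupling `Z ↔ (Y₀, …, Yₙ₊₁) ↔ γ` -/
  coupling : Markov p Z X (fun ω => ((fun i => U i ω), V ω, W ω, T ω))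

attribute [instance] Aux.fintype

namespace Aux

variable {ζ : Type} [Fintype ζ] {r : ζ × Sym A Y S → ℝ} {𝒱 : Type*}

/-- The vector `U_K = (Uᵢ)_{i ∈ K}`. -/
def UK (a : Aux r 𝒱) (K : Finset (Fin n)) (ω : a.Ω) : (i : K) → a.UAlph i :=
  fun i => a.U i ω

/-- `I(Z; U_K | Yₙ₊₁, T)` -/
def infoZ (a : Aux r 𝒱) (K : Finset (Fin n)) : ℝ :=
  condMutualInfo a.p a.Z (a.UK K) (fun ω => ((a.X ω).2.2, a.T ω))

/-- `I(Z; U_K | U_{Kᶜ}, Yₙ₊₁, T)` -/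
def infoZCompl (a : Aux r 𝒱) (K : Finset (Fin n)) : ℝ :=
  condMutualInfo a.p a.Z (a.UK K) (fun ω => (a.UK Kᶜ ω, (a.X ω).2.2, a.T ω))

/-- `I(Yᵢ; Uᵢ | Z, Yₙ₊₁, W, T)` -/
def infoY (a : Aux r 𝒱) (i : Fin n) : ℝ :=
  condMutualInfo a.p (fun ω => (a.X ω).2.1 i) (a.U i)
    (fun ω => (a.Z ω, (a.X ω).2.2, a.W ω, a.T ω))

/-- `E[d(Y₀, …, Yₙ₊₁, v)]` for a reproduction `v`. -/
def distortion {𝒱' : Type*} (a : Aux r 𝒱) (d : Sym A Y S → 𝒱' → ℝ≥0) (v : a.Ω → 𝒱') : ℝ :=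
  ∑ ω, a.p ω * (d (a.X ω) (v ω) : ℝ)

/-- The reproductions `V_{K,j}` use only the messages in `K`:
`(Y₀, Y_N, W, U_{Kᶜ}) ↔ (U_K, Yₙ₊₁, T) ↔ (V_{K,1}, …, V_{K,J})`. -/
def SubsetMarkov (a : Aux r (Msgs n → (j : Fin J) → V j)) : Prop :=
  ∀ K : Msgs n, Markov a.p
    (fun ω => ((a.X ω).1, (a.X ω).2.1, a.W ω, a.UK K.1ᶜ ω))
    (fun ω => (a.UK K.1 ω, (a.X ω).2.2, a.T ω))
    (fun ω => a.V ω K)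

end Aux

/-- The region of all `(R, D)` satisfying the sum-rate and distortion bounds for given `Z`, `γ`. -/
def outerRegionAt {ζ : Type} [Fintype ζ] {r : ζ × Sym A Y S → ℝ}
    (d : Msgs n → (j : Fin J) → Sym A Y S → V j → ℝ≥0)
    (a : Aux r (Msgs n → (j : Fin J) → V j)) : Set (RDVec n J) :=
  {RD | (∀ K : Finset (Fin n),
        max (a.infoZ K) (a.infoZCompl K) + ∑ i ∈ K, a.infoY i ≤ ∑ i ∈ K, RD.1 i) ∧
      ∀ (k : Fin n) (j : Fin J) (K : Msgs n), K.1.card = k + 1 →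
        a.distortion (d K j) (fun ω => a.V ω K j) ≤ RD.2 k j}

/-- The outer bound: the intersection over `Z` of the union over `γ`. -/
def outerRegion (q : Sym A Y S → ℝ)
    (d : Msgs n → (j : Fin J) → Sym A Y S → V j → ℝ≥0) : Set (RDVec n J) :=
  {RD | ∀ (ζ : Type) [Fintype ζ] (r : ζ × Sym A Y S → ℝ), IsPsi q r →
      ∃ a : Aux r (Msgs n → (j : Fin J) → V j), a.SubsetMarkov ∧ RD ∈ outerRegionAt d a}

/-- The Wagner–Anantharam outer bound, for `(R₁, …, Rₙ, D₁, …, D_J)`: only reproductions from all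
messages are constrained, and the sum-rate bound has `I(Z; U_K | U_{Kᶜ}, Yₙ₊₁, T)` in place of the
maximum. -/
def wagnerAnantharamRegion (q : Sym A Y S → ℝ)
    (d : (j : Fin J) → Sym A Y S → V j → ℝ≥0) : Set ((Fin n → ℝ) × (Fin J → ℝ)) :=
  {RD | ∀ (ζ : Type) [Fintype ζ] (r : ζ × Sym A Y S → ℝ), IsPsi q r →
      ∃ a : Aux r ((j : Fin J) → V j),
        (∀ K : Finset (Fin n),
          a.infoZCompl K + ∑ i ∈ K, a.infoY i ≤ ∑ i ∈ K, RD.1 i) ∧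
        ∀ j : Fin J, a.distortion (d j) (fun ω => a.V ω j) ≤ RD.2 j}

end Region

end

end MultiterminalSC

/-! Fix a code of block length `l` and a `Z` in `ψ`. Write `S` for the side information, `M_i` for
the message of encoder `i`, and let `T` be a uniform time. At `T = t` put `U_i = (M_i, Z^{t-1}, S at
times ≠ t)` and `W = (Z, S) at times ≠ t`, and let `V` be the reproduction at time `t`. Since each
`U_i` carries the remaining side information, `(U_K, S_t, T)` determines `V_K` for nonempty `K`,
which gives both Markov conditions on `V`. The other conditions come from the i.i.d. structure of
the block and from `Z ∈ ψ`.

For the rates, the chain rule (`sum_condEntropy_blockU`) sums the `Z`-terms over time to `I(Z^l; M_K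
| S^l)` and `I(Z^l; M_K | M_{Kᶜ}, S^l)`. The `Y_i`-terms sum to at most `H(M_i | Z^l, S^l)`
(`sum_condMutualInfo_blockU_le`). As the messages are conditionally independent given `(Z^l, S^l)`,
these add up over `K` to `H(M_K | Z^l, S^l) = H(M_K | M_{Kᶜ}, Z^l, S^l)` (`condEntropy_blockMsg`).
The totals are therefore at most `H(M_K | S^l)` and `H(M_K | M_{Kᶜ}, S^l)`, both bounded by the sum
of `log M_i` over `K`. One choice of auxiliaries satisfies both bounds, hence the maximum.

The comparison with Wagner and Anantharam keeps only the reproductions from all messages and the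
second term of the maximum. -/

namespace MultiterminalSC

/-! ### Laws and basic Shannon inequalities on a finite probability space. -/

section Entropy

variable {Ω : Type*} [Fintype Ω] {α β γ δ : Type*} {p : Ω → ℝ}

open Classical in
theorem law_apply (p : Ω → ℝ) (X : Ω → α) (x : α) :
    law p X x = ∑ ω, if X ω = x then p ω else 0 := by
  rw [law, Finset.sum_filter]

theorem law_nonneg (hp : ∀ ω, 0 ≤ p ω) (X : Ω → α) (x : α) : 0 ≤ law p X x :=
  Finset.sum_nonneg fun ω _ => hp ω

theorem le_law (hp : ∀ ω, 0 ≤ p ω) (X : Ω → α) (ω : Ω) : p ω ≤ law p X (X ω) := by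
  classical
  unfold law
  exact Finset.single_le_sum (f := p) (fun ω _ => hp ω) (by simp)

theorem law_pos (hp : ∀ ω, 0 ≤ p ω) (X : Ω → α) {ω : Ω} (h : p ω ≠ 0) : 0 < law p X (X ω) :=
  lt_of_lt_of_le (lt_of_le_of_ne (hp ω) h.symm) (le_law hp X ω)

theorem law_le_law (hp : ∀ ω, 0 ≤ p ω) {X : Ω → α} {Y : Ω → β} {x : α} {y : β}
    (h : ∀ ω, X ω = x → Y ω = y) : law p X x ≤ law p Y y := by
  classical
  unfold law
  refine Finset.sum_le_sum_of_subset_of_nonneg (fun ω hω => ?_) fun ω _ _ => hp ω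
  simp only [Finset.mem_filter, Finset.mem_univ, true_and] at hω ⊢
  exact h ω hω

theorem law_congr {X : Ω → α} {Y : Ω → β} {x : α} {y : β}
    (h : ∀ ω, X ω = x ↔ Y ω = y) : law p X x = law p Y y := by
  classical
  simp only [law_apply, h]

theorem law_eq_zero {X : Ω → α} {x : α} (h : ∀ ω, X ω ≠ x) : law p X x = 0 := by
  classical
  simp [law_apply, h]

theorem law_of_forall (hp : ∑ ω, p ω = 1) {X : Ω → α} {x : α} (h : ∀ ω, X ω = x) :
    law p X x = 1 := by
  classical
  simp [law_apply, h, hp]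

open Classical in
/-- Marginalization over the values of `Y`. -/
theorem law_eq_sum_image (X : Ω → α) (Y : Ω → β) (x : α) :
    law p X x = ∑ y ∈ Finset.univ.image Y, law p (fun ω => (X ω, Y ω)) (x, y) := by
  simp only [law_apply, Prod.mk.injEq]
  rw [Finset.sum_comm]
  refine Finset.sum_congr rfl fun ω _ => ?_
  by_cases h : X ω = x <;> simp [h]

theorem law_eq_sum [Fintype β] (X : Ω → α) (Y : Ω → β) (x : α) :
    law p X x = ∑ y, law p (fun ω => (X ω, Y ω)) (x, y) := by
  classical
  simp only [law_apply, Prod.mk.injEq]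
  rw [Finset.sum_comm]
  refine Finset.sum_congr rfl fun ω _ => ?_
  by_cases h : X ω = x <;> simp [h]

/-- The entropy depends only on the partition that a variable induces. -/
theorem entropy_congr {X : Ω → α} {Y : Ω → β} (h : ∀ ω ω', X ω = X ω' ↔ Y ω = Y ω') :
    entropy p X = entropy p Y := by
  unfold entropy
  refine Finset.sum_congr rfl fun ω _ => ?_
  rw [law_congr (p := p) (fun ω' => h ω' ω)]

/-- Gibbs' inequality. -/
theorem sum_mul_logb_nonpos (hp : ∀ ω, 0 ≤ p ω) (hs : ∑ ω, p ω = 1) {g : Ω → ℝ}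
    (hg : ∀ ω, p ω ≠ 0 → 0 < g ω) (h1 : ∑ ω, p ω * g ω ≤ 1) :
    ∑ ω, p ω * Real.logb 2 (g ω) ≤ 0 := by
  have h2 : ∀ ω, p ω * Real.logb 2 (g ω) ≤ (p ω * g ω - p ω) / Real.log 2 := by
    intro ω
    by_cases h0 : p ω = 0
    · simp [h0]
    rw [Real.logb, ← mul_div_assoc]
    refine div_le_div_of_nonneg_right ?_ (Real.log_nonneg one_le_two)
    have := mul_le_mul_of_nonneg_left (Real.log_le_sub_one_of_pos (hg ω h0)) (hp ω)
    linarith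
  refine (Finset.sum_le_sum fun ω _ => h2 ω).trans ?_
  rw [← Finset.sum_div, Finset.sum_sub_distrib, hs]
  exact div_nonpos_of_nonpos_of_nonneg (by linarith) (Real.log_nonneg one_le_two)

/-- Gibbs' inequality for the ratio of the uniform distribution on `α` to the law of `X`. -/
theorem entropy_le_logb_card [Fintype α] (hp : ∀ ω, 0 ≤ p ω) (hs : ∑ ω, p ω = 1) (X : Ω → α) :
    entropy p X ≤ Real.logb 2 (Fintype.card α) := by
  classical
  have hΩ : Nonempty Ω := by
    by_contra h
    rw [not_nonempty_iff] at h
    simp at hs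
  have hα : (0 : ℝ) < Fintype.card α := by
    have : Nonempty α := hΩ.map X
    exact_mod_cast Fintype.card_pos
  have key : ∑ ω, p ω * Real.logb 2 ((law p X (X ω))⁻¹ * (Fintype.card α : ℝ)⁻¹) ≤ 0 := by
    refine sum_mul_logb_nonpos hp hs (fun ω h => ?_) ?_
    · have := law_pos hp X h
      positivity
    · simp only [← mul_assoc]
      rw [← Finset.sum_mul, ← Finset.sum_fiberwise (s := Finset.univ) (g := X)]
      rw [← div_eq_mul_inv, div_le_one hα]
      calc _ ≤ ∑ x : α, (1 : ℝ) := by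
            refine Finset.sum_le_sum fun x _ => ?_
            have : ∑ ω with X ω = x, p ω * (law p X (X ω))⁻¹ = law p X x * (law p X x)⁻¹ := by
              rw [law, Finset.sum_mul]
              refine Finset.sum_congr (by congr) fun ω hω => ?_
              simp only [Finset.mem_filter, Finset.mem_univ, true_and] at hω
              rw [hω, law]
            rw [this]
            exact mul_inv_le_one
        _ = _ := by simp
  have h2 : ∑ ω, p ω * Real.logb 2 ((law p X (X ω))⁻¹ * (Fintype.card α : ℝ)⁻¹) =
      entropy p X - Real.logb 2 (Fintype.card α) := by
    rw [entropy, ← one_mul (Real.logb 2 (Fintype.card α)), ← hs, Finset.sum_mul,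
      ← Finset.sum_sub_distrib]
    refine Finset.sum_congr rfl fun ω _ => ?_
    by_cases h0 : p ω = 0
    · simp [h0]
    rw [Real.logb_mul (inv_ne_zero (law_pos hp X h0).ne') (inv_ne_zero hα.ne'), Real.logb_inv,
      Real.logb_inv]
    ring
  linarith

/-- Submodularity of the entropy. -/
theorem entropy_submodular (hp : ∀ ω, 0 ≤ p ω) (hs : ∑ ω, p ω = 1) (X : Ω → α) (Y : Ω → β)
    (C : Ω → γ) :
    entropy p (fun ω => (X ω, Y ω, C ω)) + entropy p C ≤
      entropy p (fun ω => (X ω, C ω)) + entropy p (fun ω => (Y ω, C ω)) := by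
  classical
  set a : Ω → ℝ := fun ω => law p (fun ω => (X ω, C ω)) (X ω, C ω) with ha
  set b : Ω → ℝ := fun ω => law p (fun ω => (Y ω, C ω)) (Y ω, C ω) with hb
  set c : Ω → ℝ := fun ω => law p C (C ω) with hc
  set e : Ω → ℝ := fun ω => law p (fun ω => (X ω, Y ω, C ω)) (X ω, Y ω, C ω) with he
  have ha0 : ∀ ω, p ω ≠ 0 → 0 < a ω := fun ω h => law_pos hp (fun ω => (X ω, C ω)) h
  have hb0 : ∀ ω, p ω ≠ 0 → 0 < b ω := fun ω h => law_pos hp (fun ω => (Y ω, C ω)) h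
  have hc0 : ∀ ω, p ω ≠ 0 → 0 < c ω := fun ω h => law_pos hp C h
  have he0 : ∀ ω, p ω ≠ 0 → 0 < e ω := fun ω h => law_pos hp (fun ω => (X ω, Y ω, C ω)) h
  -- Gibbs' inequality for the ratio of the law that makes `X` and `Y` conditionally independent
  -- given `C` to the true joint law.
  have key : ∑ ω, p ω * Real.logb 2 (a ω * b ω / (e ω * c ω)) ≤ 0 := by
    refine sum_mul_logb_nonpos hp hs (fun ω h => ?_) ?_
    · have := ha0 ω h; have := hb0 ω h; have := hc0 ω h; have := he0 ω h
      positivity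
    -- Expand the laws in the numerator over `ω'` (agreeing in `X`, `C`) and `ω''` (agreeing in `Y`,
    -- `C`). After exchanging sums, the sum over `ω` contributes at most 1, then the sum over `ω''`
    -- cancels `c ω'`, and the sum of `p ω'` remains.
    · have h1 : ∀ ω, p ω * (a ω * b ω / (e ω * c ω)) = ∑ ω', ∑ ω'',
          if C ω' = C ω'' then p ω' * p ω'' / c ω' *
            (if (X ω, Y ω, C ω) = (X ω', Y ω'', C ω') then
              p ω / law p (fun ω => (X ω, Y ω, C ω)) (X ω', Y ω'', C ω') else 0) else 0 := by
        intro ω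
        have : p ω * (a ω * b ω / (e ω * c ω)) = (a ω * b ω) * (p ω / (e ω * c ω)) := by ring
        rw [this, ha, hb]
        simp only [law_apply p (fun ω => (X ω, C ω)), law_apply p (fun ω => (Y ω, C ω))]
        rw [Finset.sum_mul_sum, Finset.sum_mul]
        refine Finset.sum_congr rfl fun ω' _ => ?_
        rw [Finset.sum_mul]
        refine Finset.sum_congr rfl fun ω'' _ => ?_
        simp only [Prod.mk.injEq]
        by_cases h1 : X ω' = X ω ∧ C ω' = C ω
        · by_cases h2 : Y ω'' = Y ω ∧ C ω'' = C ω
          · rw [if_pos h1, if_pos h2, if_pos (h1.2.trans h2.2.symm),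
              if_pos ⟨h1.1.symm, h2.1.symm, h1.2.symm⟩]
            simp only [hc, he, h1.1, h1.2, h2.1]
            rw [mul_comm (law p (fun ω => (X ω, Y ω, C ω)) _), ← div_div]
            ring
          · rw [if_neg h2]
            by_cases h3 : C ω' = C ω''
            · rw [if_pos h3, if_neg (show ¬(X ω = X ω' ∧ Y ω = Y ω'' ∧ C ω = C ω') from
                fun h4 => h2 ⟨h4.2.1.symm, h3.symm.trans h1.2⟩)]
              ring
            · rw [if_neg h3]
              ring
        · rw [if_neg h1, if_neg (show ¬(X ω = X ω' ∧ Y ω = Y ω'' ∧ C ω = C ω') from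
            fun h4 => h1 ⟨h4.1.symm, h4.2.2.symm⟩)]
          simp
      simp only [h1]
      rw [Finset.sum_comm]
      calc _ ≤ ∑ ω', p ω' := by
            refine Finset.sum_le_sum fun ω' _ => ?_
            rw [Finset.sum_comm]
            calc _ ≤ ∑ ω'', (if C ω'' = C ω' then p ω'' else 0) * (p ω' / c ω') := by
                  refine Finset.sum_le_sum fun ω'' _ => ?_
                  by_cases h3 : C ω' = C ω''
                  · simp only [if_pos h3, if_pos h3.symm]
                    rw [← Finset.mul_sum]
                    -- The sum is 1 unless the triple has probability zero, where `0 / 0 = 0`.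
                    have h4 : ∑ i, (if (X i, Y i, C i) = (X ω', Y ω'', C ω') then
                        p i / law p (fun ω => (X ω, Y ω, C ω)) (X ω', Y ω'', C ω') else 0) ≤ 1 := by
                      rw [← Finset.sum_filter, ← Finset.sum_div]
                      have : ∑ i with (X i, Y i, C i) = (X ω', Y ω'', C ω'), p i =
                        law p (fun ω => (X ω, Y ω, C ω)) (X ω', Y ω'', C ω') := by
                        rw [law]; congr
                      rw [this]
                      exact div_self_le_one _
                    have h5 : 0 ≤ p ω' * p ω'' / c ω' :=
                      div_nonneg (mul_nonneg (hp _) (hp _)) (law_nonneg hp _ _)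
                    calc _ ≤ p ω' * p ω'' / c ω' * 1 := mul_le_mul_of_nonneg_left h4 h5
                      _ = _ := by ring
                  · have : ¬ C ω'' = C ω' := fun h => h3 h.symm
                    simp [h3, this]
              _ = c ω' * (p ω' / c ω') := by
                  rw [← Finset.sum_mul, hc]
                  simp only [law_apply]
              _ ≤ p ω' := by
                  by_cases h : p ω' = 0
                  · simp [h]
                  · rw [mul_div_cancel₀ _ (hc0 ω' h).ne']
        _ = 1 := hs
        _ ≤ 1 := le_rfl
  have h2 : ∑ ω, p ω * Real.logb 2 (a ω * b ω / (e ω * c ω)) =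
      entropy p (fun ω => (X ω, Y ω, C ω)) + entropy p C -
      entropy p (fun ω => (X ω, C ω)) - entropy p (fun ω => (Y ω, C ω)) := by
    simp only [entropy]
    rw [← Finset.sum_add_distrib, ← Finset.sum_sub_distrib, ← Finset.sum_sub_distrib]
    refine Finset.sum_congr rfl fun ω _ => ?_
    by_cases h0 : p ω = 0
    · simp [h0]
    have h3 := (ha0 ω h0).ne'; have h4 := (hb0 ω h0).ne'
    have h5 := (hc0 ω h0).ne'; have h6 := (he0 ω h0).ne'
    rw [Real.logb_div (mul_ne_zero h3 h4) (mul_ne_zero h6 h5), Real.logb_mul h3 h4,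
      Real.logb_mul h6 h5]
    simp only [ha, hb, hc, he]
    ring
  linarith

theorem condEntropy_eq_sum_logb (hp : ∀ ω, 0 ≤ p ω) (X : Ω → α) (C : Ω → γ) :
    condEntropy p X C =
      ∑ ω, p ω * -Real.logb 2 (law p (fun ω => (X ω, C ω)) (X ω, C ω) / law p C (C ω)) := by
  rw [condEntropy, entropy, entropy, ← Finset.sum_sub_distrib]
  refine Finset.sum_congr rfl fun ω _ => ?_
  by_cases h0 : p ω = 0
  · simp [h0]
  rw [Real.logb_div (law_pos hp (fun ω => (X ω, C ω)) h0).ne' (law_pos hp C h0).ne']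
  ring

/-- For a conditionally independent family, the conditional entropies add up. -/
theorem CondIndepFamily.condEntropy_eq_sum {ι : Type*} [Fintype ι] {𝒴 : ι → Type*}
    {Y : ∀ i, Ω → 𝒴 i} {C : Ω → γ} (hp : ∀ ω, 0 ≤ p ω) (h : CondIndepFamily p Y C) :
    condEntropy p (fun ω i => Y i ω) C = ∑ i, condEntropy p (Y i) C := by
  rw [condEntropy_eq_sum_logb hp]
  simp only [condEntropy_eq_sum_logb hp]
  rw [Finset.sum_comm]
  refine Finset.sum_congr rfl fun ω _ => ?_
  by_cases h0 : p ω = 0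
  · simp [h0]
  rw [h (C ω) (law_pos hp C h0).ne' (fun i => Y i ω), Real.logb_prod, ← Finset.mul_sum,
    Finset.sum_neg_distrib]
  intro i _
  exact (div_pos (law_pos hp (fun ω => (Y i ω, C ω)) h0) (law_pos hp C h0)).ne'

end Entropy

/-! ### Markov chains and conditionally independent families. -/

section Markov

variable {Ω : Type*} [Fintype Ω] {α β γ α' β' γ' : Type*} {p : Ω → ℝ}

/-- Factorization criterion for Markov chains. -/
theorem markov_of_factor {X : Ω → α} {C : Ω → γ} {Y : Ω → β} (a : α → γ → ℝ) (b : γ → β → ℝ)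
    (h : ∀ x c y, law p (fun ω => (X ω, C ω, Y ω)) (x, c, y) = a x c * b c y) :
    Markov p X C Y := by
  classical
  -- The alphabets need not be finite, so the marginal sums run over the images of `X` and `Y`.
  have h1 : ∀ x c, law p (fun ω => (X ω, C ω)) (x, c) =
      a x c * ∑ y ∈ Finset.univ.image Y, b c y := by
    intro x c
    rw [law_eq_sum_image _ Y, Finset.mul_sum]
    refine Finset.sum_congr rfl fun y _ => ?_
    rw [← h]
    exact law_congr fun ω => by simp [and_assoc]
  have h2 : ∀ c y, law p (fun ω => (C ω, Y ω)) (c, y) =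
      (∑ x ∈ Finset.univ.image X, a x c) * b c y := by
    intro c y
    rw [law_eq_sum_image _ X, Finset.sum_mul]
    refine Finset.sum_congr rfl fun x _ => ?_
    rw [← h]
    exact law_congr fun ω => by simp; tauto
  have h3 : ∀ c, law p C c =
      (∑ x ∈ Finset.univ.image X, a x c) * ∑ y ∈ Finset.univ.image Y, b c y := by
    intro c
    rw [law_eq_sum_image _ Y, Finset.mul_sum]
    exact Finset.sum_congr rfl fun y _ => h2 c y
  intro x c y
  rw [h, h1, h2, h3]
  ring

/-- With `0 / 0 = 0` the quotient form also covers values of `C` of probability zero. -/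
theorem Markov.law_eq (hp : ∀ ω, 0 ≤ p ω) {X : Ω → α} {C : Ω → γ} {Y : Ω → β}
    (h : Markov p X C Y) (x : α) (c : γ) (y : β) :
    law p (fun ω => (X ω, C ω, Y ω)) (x, c, y) =
      law p (fun ω => (X ω, C ω)) (x, c) * (law p (fun ω => (C ω, Y ω)) (c, y) / law p C c) := by
  by_cases h0 : law p C c = 0
  · rw [h0, div_zero, mul_zero]
    refine le_antisymm ?_ (law_nonneg hp _ _)
    rw [← h0]
    exact law_le_law hp fun ω hω => by simp at hω; exact hω.2.1
  · rw [← mul_div_assoc, ← h, mul_div_cancel_right₀ _ h0]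

/-- Decomposition and weak union for Markov chains: the outer variables may be processed, and a part
of `Y` may be moved into the conditioning. -/
theorem Markov.mono (hp : ∀ ω, 0 ≤ p ω) {X : Ω → α} {C : Ω → γ} {Y : Ω → β}
    {X' : Ω → α'} {C' : Ω → γ'} {Y' : Ω → β'} (h : Markov p X C Y)
    (hX : ∀ ω ω', X ω = X ω' → C' ω = C' ω' → X' ω = X' ω')
    (hC : ∀ ω ω', C' ω = C' ω' → C ω = C ω')
    (hC' : ∀ ω ω', C ω = C ω' → Y ω = Y ω' → C' ω = C' ω')
    (hY : ∀ ω ω', Y ω = Y ω' → C' ω = C' ω' → Y' ω = Y' ω') :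
    Markov p X' C' Y' := by
  classical
  rcases isEmpty_or_nonempty Ω with hΩ | ⟨⟨ω₀⟩⟩
  · intro x c y
    simp [law_apply]
  have : Nonempty α' := ⟨X' ω₀⟩
  have : Nonempty β' := ⟨Y' ω₀⟩
  have : Nonempty γ' := ⟨C' ω₀⟩
  have : Nonempty γ := ⟨C ω₀⟩
  -- The hypotheses say which variables determine which; here they become actual functions.
  obtain ⟨eX, heX⟩ := (Function.factorsThrough_iff (f := fun ω => (X ω, C' ω)) X').1
    (fun ω ω' hω => by simp at hω; exact hX _ _ hω.1 hω.2)
  obtain ⟨eY, heY⟩ := (Function.factorsThrough_iff (f := fun ω => (Y ω, C' ω)) Y').1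
    (fun ω ω' hω => by simp at hω; exact hY _ _ hω.1 hω.2)
  obtain ⟨eC, heC⟩ := (Function.factorsThrough_iff (f := C') C).1 (fun ω ω' hω => hC _ _ hω)
  obtain ⟨eC', heC'⟩ := (Function.factorsThrough_iff (f := fun ω => (C ω, Y ω)) C').1
    (fun ω ω' hω => by simp at hω; exact hC' _ _ hω.1 hω.2)
  have heX : ∀ ω, X' ω = eX (X ω, C' ω) := fun ω => congrFun heX ω
  have heY : ∀ ω, Y' ω = eY (Y ω, C' ω) := fun ω => congrFun heY ω
  have heC : ∀ ω, C ω = eC (C' ω) := fun ω => congrFun heC ω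
  have heC' : ∀ ω, C' ω = eC' (C ω, Y ω) := fun ω => congrFun heC' ω
  -- For fixed `c'`, the pairs `(x, y)` compatible with `(x', c', y')` are cut out by a condition on
  -- `x` alone and one on `y` alone. Consistency of `C'` falls on the `y` side because `(C, Y)`
  -- determines `C'`.
  refine markov_of_factor
    (fun x' c' => ∑ x ∈ Finset.univ.image X,
      if eX (x, c') = x' then law p (fun ω => (X ω, C ω)) (x, eC c') else 0)
    (fun c' y' => ∑ y ∈ Finset.univ.image Y,
      if eY (y, c') = y' ∧ eC' (eC c', y) = c' then
        law p (fun ω => (C ω, Y ω)) (eC c', y) / law p C (eC c') else 0) ?_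
  intro x' c' y'
  rw [law_eq_sum_image _ X, Finset.sum_mul]
  refine Finset.sum_congr rfl fun x _ => ?_
  rw [law_eq_sum_image _ Y, Finset.mul_sum]
  refine Finset.sum_congr rfl fun y _ => ?_
  by_cases h1 : eX (x, c') = x'
  · by_cases h2 : eY (y, c') = y' ∧ eC' (eC c', y) = c'
    · rw [if_pos h1, if_pos h2, ← h.law_eq hp]
      refine law_congr fun ω => ?_
      simp only [Prod.mk.injEq]
      constructor
      · rintro ⟨⟨⟨-, hc, -⟩, hx⟩, hy⟩
        exact ⟨hx, by rw [heC, hc], hy⟩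
      · rintro ⟨hx, hc, hy⟩
        have hc' : C' ω = c' := by rw [heC', hc, hy, h2.2]
        exact ⟨⟨⟨by rw [heX, hx, hc', h1], hc', by rw [heY, hy, hc', h2.1]⟩, hx⟩, hy⟩
    · rw [if_neg h2, mul_zero]
      refine law_eq_zero fun ω hω => h2 ?_
      simp only [Prod.mk.injEq] at hω
      obtain ⟨⟨⟨-, hc, hy'⟩, hx⟩, hy⟩ := hω
      exact ⟨by rw [← hy, ← hc, ← heY, hy'], by rw [← hc, ← heC, ← hy, ← heC']⟩
  · rw [if_neg h1, zero_mul]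
    refine law_eq_zero fun ω hω => h1 ?_
    simp only [Prod.mk.injEq] at hω
    obtain ⟨⟨⟨hx', hc, -⟩, hx⟩, hy⟩ := hω
    rw [← hx, ← hc, ← heX, hx']

/-- A function of the conditioning variable completes a Markov chain. -/
theorem markov_of_determines {X : Ω → α} {C : Ω → γ} {Y : Ω → β}
    (h : ∀ ω ω', C ω = C ω' → Y ω = Y ω') : Markov p X C Y := by
  intro x c y
  by_cases h1 : ∃ ω, C ω = c ∧ Y ω = y
  · obtain ⟨ω₀, rfl, rfl⟩ := h1
    congr 1
    · exact law_congr fun ω => by simp only [Prod.mk.injEq]; exact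
        ⟨fun h => ⟨h.1, h.2.1⟩, fun h' => ⟨h'.1, h'.2, h _ _ h'.2⟩⟩
    · exact law_congr fun ω => by simp only [Prod.mk.injEq]; exact
        ⟨fun h' => ⟨h', h _ _ h'⟩, fun h' => h'.1⟩
  · push Not at h1
    rw [law_eq_zero (X := fun ω => (X ω, C ω, Y ω)), law_eq_zero (X := fun ω => (C ω, Y ω))]
    · simp
    · intro ω hω
      simp only [Prod.mk.injEq] at hω
      exact h1 ω hω.1 hω.2
    · intro ω hω
      simp only [Prod.mk.injEq] at hω
      exact h1 ω hω.2.1 hω.2.2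

/-- A family which is conditionally independent stays so under processing of its members. -/
theorem CondIndepFamily.comp {ι : Type*} [Fintype ι] {𝒴 𝒴' : ι → Type*} [∀ i, Fintype (𝒴 i)]
    {Y : ∀ i, Ω → 𝒴 i} {C : Ω → γ} (h : CondIndepFamily p Y C) (f : ∀ i, 𝒴 i → 𝒴' i) :
    CondIndepFamily p (fun i ω => f i (Y i ω)) C := by
  classical
  intro c hc y'
  have h1 : ∀ i, law p (fun ω => (f i (Y i ω), C ω)) (y' i, c) =
      ∑ y with f i y = y' i, law p (fun ω => (Y i ω, C ω)) (y, c) := by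
    intro i
    rw [law_eq_sum _ (Y i), Finset.sum_filter]
    refine Finset.sum_congr rfl fun y _ => ?_
    split_ifs with h2
    · exact law_congr fun ω => by
        simp only [Prod.mk.injEq]
        exact ⟨fun h => ⟨h.2, h.1.2⟩, fun h => ⟨⟨h.1 ▸ h2, h.2⟩, h.1⟩⟩
    · exact law_eq_zero fun ω hω => h2 (by
        simp only [Prod.mk.injEq] at hω
        rw [← hω.2, hω.1.1])
  -- The preimage of `y'` is a product set, so the sum over it of a product is a product of sums.
  have h2 : law p (fun ω => ((fun i => f i (Y i ω)), C ω)) (y', c) =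
      ∑ y ∈ Fintype.piFinset (fun i => Finset.univ.filter fun y => f i y = y' i),
        law p (fun ω => ((fun i => Y i ω), C ω)) (y, c) := by
    rw [law_eq_sum _ (fun ω i => Y i ω)]
    rw [← Finset.sum_subset (Finset.subset_univ
      (Fintype.piFinset (fun i => Finset.univ.filter fun y => f i y = y' i)))]
    · refine Finset.sum_congr rfl fun y hy => ?_
      simp only [Fintype.mem_piFinset, Finset.mem_filter, Finset.mem_univ, true_and] at hy
      refine law_congr fun ω => ?_
      simp only [Prod.mk.injEq]
      exact ⟨fun h => ⟨h.2, h.1.2⟩, fun h => ⟨⟨by funext i; rw [← hy i, ← h.1], h.2⟩, h.1⟩⟩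
    · intro y _ hy
      refine law_eq_zero fun ω hω => hy ?_
      simp only [Prod.mk.injEq] at hω
      simp only [Fintype.mem_piFinset, Finset.mem_filter, Finset.mem_univ, true_and]
      intro i
      rw [← hω.2, ← hω.1.1]
  simp only [h1, h2, Finset.sum_div]
  rw [Finset.prod_univ_sum]
  exact Finset.sum_congr rfl fun y _ => h c hc y

/-- Each member of a conditionally independent family forms a Markov chain with the others. -/
theorem CondIndepFamily.markov {ι : Type*} [Fintype ι] {𝒴 : ι → Type*} [∀ i, Fintype (𝒴 i)]
    {Y : ∀ i, Ω → 𝒴 i} {C : Ω → γ} (hp : ∀ ω, 0 ≤ p ω) (h : CondIndepFamily p Y C) (i : ι) :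
    Markov p (Y i) C (fun ω (k : {k // k ≠ i}) => Y k ω) := by
  classical
  refine markov_of_factor (fun y c => law p (fun ω => (Y i ω, C ω)) (y, c) / law p C c)
    (fun c y => law p C c * ∏ k : {k // k ≠ i}, law p (fun ω => (Y k ω, C ω)) (y k, c) / law p C c)
    ?_
  intro x c y
  by_cases hc : law p C c = 0
  · rw [hc, zero_mul, mul_zero]
    refine le_antisymm ?_ (law_nonneg hp _ _)
    rw [← hc]
    exact law_le_law hp fun ω hω => by simp at hω; exact hω.2.1
  -- Glue `x` at position `i` and `y` elsewhere into one vector, to which conditional independence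
  -- applies.
  obtain ⟨w, hwi, hw⟩ : ∃ w : ∀ k, 𝒴 k, w i = x ∧ ∀ k : {k // k ≠ i}, w k = y k :=
    ⟨fun k => if hk : k = i then hk ▸ x else y ⟨k, hk⟩, by simp, fun k => dif_neg k.2⟩
  have h1 := h c hc w
  rw [Fintype.prod_eq_mul_prod_subtype_ne _ i] at h1
  have h2 : law p (fun ω => (Y i ω, C ω, fun k : {k // k ≠ i} => Y k ω)) (x, c, y) =
      law p (fun ω => ((fun i => Y i ω), C ω)) (w, c) := by
    refine law_congr fun ω => ?_
    simp only [Prod.mk.injEq]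
    constructor
    · rintro ⟨hx, hc, hy⟩
      refine ⟨funext fun k => ?_, hc⟩
      by_cases hk : k = i
      · subst hk
        rw [hwi, hx]
      · exact (congrFun hy ⟨k, hk⟩).trans (hw ⟨k, hk⟩).symm
    · rintro ⟨hy, hc⟩
      exact ⟨(congrFun hy i).trans hwi, hc, funext fun k => (congrFun hy k).trans (hw k)⟩
  rw [h2, ← mul_div_cancel_left₀ (law p _ _) hc, mul_div_assoc, h1, hwi]
  simp only [hw]
  ring

end Markov

/-! ### Restriction of vectors to sets of positions. -/

section Mask

variable {ι α : Type*}

open Classical in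
/-- The entries of the vector `v` at the positions in `P`. -/
noncomputable def mask (P : ι → Prop) (v : ι → α) : ι → Option α :=
  fun s => if P s then some (v s) else none

theorem mask_eq_mask {P : ι → Prop} {v w : ι → α} :
    mask P v = mask P w ↔ ∀ s, P s → v s = w s := by
  rw [funext_iff]
  refine forall_congr' fun s => ?_
  by_cases h : P s <;> simp [mask, h]

end Mask

/-! ### Telescoping chain rule and subadditivity. -/

section Entropy

variable {Ω : Type*} [Fintype Ω] {α β γ : Type*} {p : Ω → ℝ}

theorem sum_fin_sub_succ (F : ℕ → ℝ) (l : ℕ) :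
    ∑ t : Fin l, (F (t + 1) - F t) = F l - F 0 := by
  rw [Fin.sum_univ_eq_sum_range (fun m => F (m + 1) - F m) l, Finset.sum_range_sub]

/-- Subadditivity of the conditional entropy. -/
theorem condEntropy_le_sum (hp : ∀ ω, 0 ≤ p ω) (hs : ∑ ω, p ω = 1) {l : ℕ} (Y : Fin l → Ω → α)
    (C : Ω → γ) : condEntropy p (fun ω t => Y t ω) C ≤ ∑ t, condEntropy p (Y t) C := by
  -- `F m` is the joint entropy of `C` and the first `m` letters. Its increments are the chain-rule
  -- terms, each bounded by submodularity.
  set F : ℕ → ℝ := fun m =>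
    entropy p (fun ω => (mask (fun t : Fin l => (t : ℕ) < m) (fun t => Y t ω), C ω)) with hF
  have h1 : condEntropy p (fun ω t => Y t ω) C = F l - F 0 := by
    rw [condEntropy]
    congr 1
    · exact entropy_congr fun ω ω' => by simp only [Prod.mk.injEq, mask_eq_mask]; simp [funext_iff]
    · exact entropy_congr fun ω ω' => by simp [mask_eq_mask]
  rw [h1, ← sum_fin_sub_succ]
  refine Finset.sum_le_sum fun t _ => ?_
  have h2 := entropy_submodular hp hs (Y t)
    (fun ω => mask (fun s : Fin l => (s : ℕ) < t) (fun s => Y s ω)) C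
  have h3 : F (t + 1) = entropy p
      (fun ω => (Y t ω, mask (fun s : Fin l => (s : ℕ) < t) (fun s => Y s ω), C ω)) := by
    refine entropy_congr fun ω ω' => ?_
    simp only [Prod.mk.injEq, mask_eq_mask, ← and_assoc]
    refine and_congr_left fun _ => ⟨fun h => ⟨h t (by omega), fun s hs => h s (by omega)⟩, ?_⟩
    rintro ⟨h, h'⟩ s hs
    rcases Nat.lt_succ_iff_lt_or_eq.1 hs with h4 | h4
    · exact h' s h4
    · rwa [Fin.ext h4]
  rw [condEntropy]
  simp only [hF] at h3 ⊢
  linarith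

end Entropy

/-! ### Blocks of independent symbols. -/

section Product

variable {E : Type*} {α β γ : Type*} {r : E → ℝ} {l : ℕ}

/-- The law of a block of `l` independent symbols with law `r`. -/
def iidWeight (r : E → ℝ) (l : ℕ) (x : Fin l → E) : ℝ :=
  ∏ t, r (x t)

theorem iidWeight_nonneg (hr : ∀ e, 0 ≤ r e) (x : Fin l → E) : 0 ≤ iidWeight r l x :=
  Finset.prod_nonneg fun t _ => hr (x t)

variable [Fintype E]

/-- The event is a product set. Letting `G` vary with the position makes it possible to single out
one time by maps that are constant at the others. -/
theorem law_iidWeight {β : Fin l → Type*} (G : ∀ s, E → β s) (y : ∀ s, β s) :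
    law (iidWeight r l) (fun x s => G s (x s)) y = ∏ s, law r (G s) (y s) := by
  classical
  simp only [law]
  rw [Finset.prod_univ_sum]
  refine Finset.sum_congr ?_ fun x _ => rfl
  ext x
  simp [funext_iff]

theorem sum_iidWeight (hs : ∑ e, r e = 1) : ∑ x, iidWeight r l x = 1 := by
  classical
  have := law_iidWeight (r := r) (l := l) (fun _ _ => ()) fun _ => ()
  simpa [law, hs] using this

theorem law_iidWeight_apply (hs : ∑ e, r e = 1) (G : E → β) (t : Fin l) (y : β) :
    law (iidWeight r l) (fun x => G (x t)) y = law r G y := by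
  classical
  have h := law_iidWeight (r := r) (fun s : Fin l => if s = t then fun e => some (G e) else
    fun _ => none) fun s => if s = t then some y else none
  rw [Finset.prod_eq_single t] at h
  · rw [if_pos rfl, if_pos rfl] at h
    rw [← law_congr (X := fun e => some (G e)) (x := some y) (fun e => by simp), ← h]
    refine law_congr fun x => ?_
    rw [funext_iff]
    constructor
    · intro h s
      by_cases hs : s = t
      · subst hs; simp [h]
      · simp [hs]
    · intro h
      simpa using h t
  · intro s _ hst
    rw [if_neg hst, if_neg hst]
    exact law_of_forall hs fun _ => rfl
  · simp

/-- All four laws are products over positions, so the identity holds factor by factor. The chain may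
vary with the position, which lets `Markov.block` and `Markov.letter` treat time `t` separately. -/
theorem Markov.iidWeight {α β γ : Type*} {X : Fin l → E → α} {C : Fin l → E → γ}
    {Y : Fin l → E → β} (h : ∀ s, Markov r (X s) (C s) (Y s)) :
    Markov (iidWeight r l) (fun x s => X s (x s)) (fun x s => C s (x s)) (fun x s => Y s (x s)) := by
  intro x c y
  have h1 : law (MultiterminalSC.iidWeight r l)
      (fun ω => ((fun s => X s (ω s)), (fun s => C s (ω s)), (fun s => Y s (ω s)))) (x, c, y) =
      ∏ s, law r (fun e => (X s e, C s e, Y s e)) (x s, c s, y s) := by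
    rw [← law_iidWeight (fun s e => (X s e, C s e, Y s e)) fun s => (x s, c s, y s)]
    exact law_congr fun ω => by simp [funext_iff, forall_and]
  have h2 : law (MultiterminalSC.iidWeight r l)
      (fun ω => ((fun s => X s (ω s)), (fun s => C s (ω s)))) (x, c) =
      ∏ s, law r (fun e => (X s e, C s e)) (x s, c s) := by
    rw [← law_iidWeight (fun s e => (X s e, C s e)) fun s => (x s, c s)]
    exact law_congr fun ω => by simp [funext_iff, forall_and]
  have h3 : law (MultiterminalSC.iidWeight r l)
      (fun ω => ((fun s => C s (ω s)), (fun s => Y s (ω s)))) (c, y) =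
      ∏ s, law r (fun e => (C s e, Y s e)) (c s, y s) := by
    rw [← law_iidWeight (fun s e => (C s e, Y s e)) fun s => (c s, y s)]
    exact law_congr fun ω => by simp [funext_iff, forall_and]
  rw [h1, h2, h3, law_iidWeight C c, ← Finset.prod_mul_distrib, ← Finset.prod_mul_distrib]
  exact Finset.prod_congr rfl fun s _ => h s _ _ _

theorem law_iidWeight_pair (G : E → β) (C : E → γ) (y : Fin l → β) (c : Fin l → γ) :
    law (iidWeight r l) (fun x => ((fun s => G (x s)), (fun s => C (x s)))) (y, c) =
      ∏ s, law r (fun e => (G e, C e)) (y s, c s) := by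
  rw [← law_iidWeight (fun _ e => (G e, C e)) fun s => (y s, c s)]
  exact law_congr fun ω => by simp [funext_iff, forall_and]

/-- The letters of one component of an i.i.d. block are conditionally independent given the block of
another component. -/
theorem condIndepFamily_letters (G : E → β) (C : E → γ) :
    CondIndepFamily (iidWeight r l) (fun t x => G (x t)) (fun x s => C (x s)) := by
  classical
  intro c hc y
  rw [law_iidWeight_pair]
  rw [law_iidWeight (fun _ => C) c] at hc ⊢
  rw [← Finset.prod_div_distrib]
  refine Finset.prod_congr rfl fun t _ => ?_
  -- `G` is observed only at time `t`, so the factors at the other times cancel against those of the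
  -- law of `C^l`.
  have h : law (iidWeight r l) (fun x => (G (x t), fun s => C (x s))) (y t, c) =
      ∏ s, law r (fun e => (if s = t then some (G e) else none, C e))
        (if s = t then some (y t) else none, c s) := by
    rw [← law_iidWeight (fun s e => (if s = t then some (G e) else none, C e))
      fun s => (if s = t then some (y t) else none, c s)]
    refine law_congr fun x => ?_
    simp only [Prod.mk.injEq, funext_iff, forall_and]
    refine and_congr_left fun _ => ⟨fun h s => ?_, fun h => by simpa using h t⟩
    by_cases hs : s = t
    · simp [hs, h]
    · simp [hs]
  rw [h, ← Finset.mul_prod_erase _ _ (Finset.mem_univ t),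
    ← Finset.mul_prod_erase _ (fun s => law r C (c s)) (Finset.mem_univ t)]
  have h2 : ∏ s ∈ Finset.univ.erase t, law r (fun e => (if s = t then some (G e) else none, C e))
        (if s = t then some (y t) else none, c s) =
      ∏ s ∈ Finset.univ.erase t, law r C (c s) := by
    refine Finset.prod_congr rfl fun s hs => law_congr fun e => ?_
    simp [Finset.ne_of_mem_erase hs]
  have h3 : law r (fun e => (if t = t then some (G e) else none, C e))
      (if t = t then some (y t) else none, c t) = law r (fun e => (G e, C e)) (y t, c t) :=
    law_congr fun e => by simp
  rw [h2, h3, mul_div_mul_right]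
  rw [Finset.prod_ne_zero_iff] at hc ⊢
  exact fun s _ => hc s (Finset.mem_univ s)

/-- Conditional independence of the components of a symbol passes to i.i.d. blocks. -/
theorem CondIndepFamily.iidWeight {ι : Type*} [Fintype ι] {𝒴 : ι → Type*} {Y : ∀ i, E → 𝒴 i}
    {C : E → γ} (h : CondIndepFamily r Y C) :
    CondIndepFamily (iidWeight r l) (fun i x s => Y i (x s)) (fun x s => C (x s)) := by
  intro c hc y
  have h1 : law (MultiterminalSC.iidWeight r l)
      (fun x => ((fun i s => Y i (x s)), fun s => C (x s))) (y, c) =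
      ∏ s, law r (fun e => ((fun i => Y i e), C e)) (fun i => y i s, c s) := by
    rw [← law_iidWeight_pair (fun e i => Y i e)]
    refine law_congr fun x => ?_
    simp only [Prod.mk.injEq, funext_iff]
    rw [forall_comm]
  rw [h1]
  simp only [law_iidWeight_pair]
  rw [law_iidWeight (fun _ => C) c] at hc ⊢
  simp only [← Finset.prod_div_distrib]
  rw [Finset.prod_comm]
  rw [Finset.prod_ne_zero_iff] at hc
  exact Finset.prod_congr rfl fun s _ => h (c s) (hc s (Finset.mem_univ s)) _

end Product

/-! ### A uniformly random time. -/

section Mixture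

variable {Ω : Type*} {α β γ : Type*} {p : Ω → ℝ} {l : ℕ}

/-- The weight of `(t, ω)`, where `t` is uniform on `Fin l` and independent of `ω`. -/
noncomputable def mixWeight (p : Ω → ℝ) (l : ℕ) (ω : Fin l × Ω) : ℝ :=
  1 / (l : ℝ) * p ω.2

theorem mixWeight_nonneg (hp : ∀ ω, 0 ≤ p ω) (ω : Fin l × Ω) : 0 ≤ mixWeight p l ω :=
  mul_nonneg (by positivity) (hp _)

variable [Fintype Ω]

theorem sum_mixWeight (hl : 0 < l) (hs : ∑ ω, p ω = 1) : ∑ ω, mixWeight p l ω = 1 := by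
  have : (l : ℝ) ≠ 0 := by positivity
  simp [mixWeight, Fintype.sum_prod_type, ← Finset.mul_sum, hs, this]

theorem law_mixWeight (X : Fin l × Ω → α) (x : α) :
    law (mixWeight p l) X x = 1 / (l : ℝ) * ∑ t, law p (fun ω => X (t, ω)) x := by
  classical
  simp only [law_apply, mixWeight, Fintype.sum_prod_type, Finset.mul_sum, mul_ite, mul_zero]

theorem law_mixWeight_of_const (hl : 0 < l) {X : Fin l × Ω → α} {x : α} {v : ℝ}
    (h : ∀ t, law p (fun ω => X (t, ω)) x = v) : law (mixWeight p l) X x = v := by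
  have : (l : ℝ) ≠ 0 := by positivity
  simp [law_mixWeight, h, this]

theorem law_mixWeight_of_time {X : Fin l × Ω → α} {x : α} {t : Fin l}
    (h : ∀ ω, X ω = x → ω.1 = t) :
    law (mixWeight p l) X x = 1 / (l : ℝ) * law p (fun ω => X (t, ω)) x := by
  classical
  rw [law_mixWeight, Finset.sum_eq_single t]
  · intro s _ hst
    exact law_eq_zero fun ω hω => hst (h _ hω)
  · simp

/-- Since `X` reveals the time, each of its values has `1 / l` times its probability at that time;
the factor adds `log l` to the entropy. -/
theorem entropy_mixWeight (hl : 0 < l) (hp : ∀ ω, 0 ≤ p ω) (hs : ∑ ω, p ω = 1)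
    {X : Fin l × Ω → α} (h : ∀ ω ω', X ω = X ω' → ω.1 = ω'.1) :
    entropy (mixWeight p l) X =
      Real.logb 2 l + 1 / (l : ℝ) * ∑ t, entropy p (fun ω => X (t, ω)) := by
  have hl' : (l : ℝ) ≠ 0 := by positivity
  have h1 : Real.logb 2 l = ∑ ω, mixWeight p l ω * Real.logb 2 l := by
    rw [← Finset.sum_mul, sum_mixWeight hl hs, one_mul]
  rw [h1]
  simp only [entropy, Fintype.sum_prod_type, Finset.mul_sum]
  simp only [← Finset.sum_add_distrib]
  refine Finset.sum_congr rfl fun t _ => Finset.sum_congr rfl fun ω _ => ?_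
  rw [law_mixWeight_of_time (t := t) fun ω' hω' => h _ _ hω', mixWeight]
  by_cases h0 : p ω = 0
  · simp [h0]
  rw [Real.logb_mul (by positivity) (law_pos hp (fun ω => X (t, ω)) h0).ne', one_div,
    Real.logb_inv]
  ring

/-- As `C` reveals the time, all four entropies carry the same `log l`, which cancels. -/
theorem condMutualInfo_mixWeight (hl : 0 < l) (hp : ∀ ω, 0 ≤ p ω) (hs : ∑ ω, p ω = 1)
    (X : Fin l × Ω → α) (Y : Fin l × Ω → β) {C : Fin l × Ω → γ}
    (h : ∀ ω ω', C ω = C ω' → ω.1 = ω'.1) :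
    condMutualInfo (mixWeight p l) X Y C = 1 / (l : ℝ) * ∑ t, condMutualInfo p
      (fun ω => X (t, ω)) (fun ω => Y (t, ω)) (fun ω => C (t, ω)) := by
  simp only [condMutualInfo, condEntropy, Finset.sum_sub_distrib]
  rw [entropy_mixWeight hl hp hs h,
    entropy_mixWeight (X := fun ω => (X ω, C ω)) hl hp hs fun ω ω' hω => h _ _ (congrArg (·.2) hω),
    entropy_mixWeight (X := fun ω => (Y ω, C ω)) hl hp hs fun ω ω' hω => h _ _ (congrArg (·.2) hω),
    entropy_mixWeight (X := fun ω => (X ω, Y ω, C ω)) hl hp hs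
      fun ω ω' hω => h _ _ (congrArg (·.2.2) hω)]
  ring

/-- A Markov chain may be checked at each time when the conditioning reveals the time. -/
theorem Markov.mixWeight {X : Fin l × Ω → α} {C : Fin l × Ω → γ} {Y : Fin l × Ω → β}
    (hC : ∀ ω ω', C ω = C ω' → ω.1 = ω'.1)
    (h : ∀ t, Markov p (fun ω => X (t, ω)) (fun ω => C (t, ω)) (fun ω => Y (t, ω))) :
    Markov (mixWeight p l) X C Y := by
  intro x c y
  by_cases hc : ∃ ω, C ω = c
  · obtain ⟨ω₀, rfl⟩ := hc
    rw [law_mixWeight_of_time (X := C) (t := ω₀.1) fun ω hω => hC _ _ hω,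
      law_mixWeight_of_time (X := fun ω => (X ω, C ω)) (t := ω₀.1)
        fun ω hω => hC _ _ (congrArg (·.2) hω),
      law_mixWeight_of_time (X := fun ω => (C ω, Y ω)) (t := ω₀.1)
        fun ω hω => hC _ _ (congrArg (·.1) hω),
      law_mixWeight_of_time (X := fun ω => (X ω, C ω, Y ω)) (t := ω₀.1)
        fun ω hω => hC _ _ (congrArg (·.2.1) hω)]
    have := h ω₀.1 x (C ω₀) y
    linear_combination (1 / (l : ℝ)) ^ 2 * this
  · push Not at hc
    rw [law_eq_zero (X := C) hc, law_eq_zero (X := fun ω => (X ω, C ω)), mul_zero, zero_mul]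
    exact fun ω hω => hc ω (congrArg (·.2) hω)

/-- A Markov chain may be checked at each time when `Y` reveals the time and the law of `(X, C)` does
not depend on it. -/
theorem Markov.mixWeight_of_stationary (hl : 0 < l) {X : Fin l × Ω → α} {C : Fin l × Ω → γ}
    {Y : Fin l × Ω → β} (hY : ∀ ω ω', Y ω = Y ω' → ω.1 = ω'.1)
    (h : ∀ t, Markov p (fun ω => X (t, ω)) (fun ω => C (t, ω)) (fun ω => Y (t, ω)))
    {v : α → γ → ℝ} {w : γ → ℝ}
    (hv : ∀ t x c, law p (fun ω => (X (t, ω), C (t, ω))) (x, c) = v x c)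
    (hw : ∀ t c, law p (fun ω => C (t, ω)) c = w c) :
    Markov (MultiterminalSC.mixWeight p l) X C Y := by
  intro x c y
  by_cases hy : ∃ ω, Y ω = y
  · obtain ⟨ω₀, rfl⟩ := hy
    rw [law_mixWeight_of_const (X := C) hl fun t => hw t c,
      law_mixWeight_of_const (X := fun ω => (X ω, C ω)) hl fun t => hv t x c,
      law_mixWeight_of_time (X := fun ω => (C ω, Y ω)) (t := ω₀.1)
        fun ω hω => hY _ _ (congrArg (·.2) hω),
      law_mixWeight_of_time (X := fun ω => (X ω, C ω, Y ω)) (t := ω₀.1)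
        fun ω hω => hY _ _ (congrArg (·.2.2) hω)]
    have := h ω₀.1 x c (Y ω₀)
    rw [hv, hw] at this
    linear_combination (1 / (l : ℝ)) * this
  · push Not at hy
    rw [law_eq_zero (X := fun ω => (C ω, Y ω)), law_eq_zero (X := fun ω => (X ω, C ω, Y ω)),
      mul_zero, zero_mul]
    · exact fun ω hω => hy ω (congrArg (·.2.2) hω)
    · exact fun ω hω => hy ω (congrArg (·.2) hω)

end Mixture

/-! ### Change of variables, and entropies of subfamilies. -/

section Entropy

variable {Ω : Type*} [Fintype Ω] {α β γ γ' : Type*} {p : Ω → ℝ}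

theorem sum_mul_comp_eq_sum_law [Fintype α] (X : Ω → α) (h : α → ℝ) :
    ∑ ω, p ω * h (X ω) = ∑ x, law p X x * h x := by
  classical
  simp only [law_apply, Finset.sum_mul]
  rw [Finset.sum_comm]
  simp

theorem law_of_injective {X : Ω → α} (hX : Function.Injective X) (ω : Ω) :
    law p X (X ω) = p ω := by
  classical
  simp [law_apply, hX.eq_iff]

theorem condEntropy_congr (X : Ω → α) {C : Ω → γ} {C' : Ω → γ'}
    (h : ∀ ω ω', C ω = C ω' ↔ C' ω = C' ω') : condEntropy p X C = condEntropy p X C' := by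
  rw [condEntropy, condEntropy, entropy_congr h,
    entropy_congr (X := fun ω => (X ω, C ω)) (Y := fun ω => (X ω, C' ω))
      fun ω ω' => by simp only [Prod.mk.injEq, h]]

theorem entropy_pair_le (hp : ∀ ω, 0 ≤ p ω) (hs : ∑ ω, p ω = 1) (X : Ω → α) (Y : Ω → β) :
    entropy p (fun ω => (X ω, Y ω)) ≤ entropy p X + entropy p Y := by
  have h := entropy_submodular hp hs X Y fun _ => ()
  have h0 : entropy p (fun _ : Ω => ()) = 0 := by
    simp [entropy, law_of_forall hs]
  rw [h0, add_zero] at h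
  convert h using 1
  · exact entropy_congr fun ω ω' => by simp
  · congr 1 <;> exact entropy_congr fun ω ω' => by simp

/-- Replacing the members outside `K` by a constant preserves conditional independence, and
constants contribute no entropy. -/
theorem CondIndepFamily.condEntropy_subset {ι : Type*} [Fintype ι] {𝒴 : ι → Type*}
    [∀ i, Fintype (𝒴 i)] {Y : ∀ i, Ω → 𝒴 i} {C : Ω → γ} (hp : ∀ ω, 0 ≤ p ω)
    (h : CondIndepFamily p Y C) (K : Finset ι) :
    condEntropy p (fun ω (i : K) => Y i ω) C = ∑ i ∈ K, condEntropy p (Y i) C := by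
  classical
  have h1 := (h.comp (𝒴' := fun i => Option (𝒴 i))
    fun i y => if i ∈ K then some y else none).condEntropy_eq_sum hp
  have h2 : condEntropy p (fun ω (i : K) => Y i ω) C =
      condEntropy p (fun ω i => if i ∈ K then some (Y i ω) else none) C := by
    rw [condEntropy, condEntropy]
    congr 1
    refine entropy_congr fun ω ω' => ?_
    simp only [Prod.mk.injEq, funext_iff, Subtype.forall]
    refine and_congr_left fun _ => forall_congr' fun i => ?_
    by_cases hi : i ∈ K <;> simp [hi]
  rw [h2, h1, ← Finset.sum_subset (Finset.subset_univ K)]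
  · refine Finset.sum_congr rfl fun i hi => ?_
    rw [condEntropy, condEntropy]
    congr 1
    exact entropy_congr fun ω ω' => by simp [hi]
  · intro i _ hi
    rw [condEntropy, sub_eq_zero]
    exact entropy_congr fun ω ω' => by simp [hi]

end Entropy

/-! ### Markov chains in a block around a fixed time. -/

section Markov

variable {Ω : Type*} [Fintype Ω] {α β γ : Type*} {p : Ω → ℝ}

theorem Markov.symm {X : Ω → α} {C : Ω → γ} {Y : Ω → β} (h : Markov p X C Y) :
    Markov p Y C X := by
  intro y c x
  rw [law_congr (Y := fun ω => (X ω, C ω, Y ω)) (y := (x, c, y)) fun ω => by simp; tauto, h,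
    mul_comm]
  congr 1
  · exact law_congr fun ω => by simp; tauto
  · exact law_congr fun ω => by simp; tauto

/-- In an i.i.d. block, a Markov chain holds between the letters at the times other than `t`, jointly
with the whole letter at time `t`. -/
theorem Markov.block {E : Type*} [Fintype E] {r : E → ℝ} (hr : ∀ e, 0 ≤ r e)
    {X : E → α} {C : E → γ} {Y : E → β} (h : Markov r X C Y) {l : ℕ} (t : Fin l) :
    Markov (MultiterminalSC.iidWeight r l) (fun x => mask (· ≠ t) fun s => X (x s))
      (fun x => mask (· ≠ t) fun s => C (x s))
      (fun x => (x t, mask (· ≠ t) fun s => Y (x s))) := by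
  classical
  -- At time `t` the outer variable `X` and the middle variable are constant, so `Y` may be the
  -- whole letter there.
  have h1 := Markov.iidWeight (r := r) (l := l)
    (X := fun s e => if s = t then none else some (X e))
    (C := fun s e => if s = t then none else some (C e))
    (Y := fun s e => if s = t then Sum.inl e else Sum.inr (Y e)) fun s => by
      by_cases hs : s = t
      · simp only [if_pos hs]
        exact (markov_of_determines fun _ _ _ => rfl).symm
      · simp only [if_neg hs]
        exact h.mono hr (fun _ _ h _ => by rw [h]) (fun _ _ h => by simpa using h)
          (fun _ _ h _ => by rw [h]) fun _ _ h _ => by rw [h]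
  refine h1.mono (iidWeight_nonneg hr) ?_ ?_ ?_ ?_
  · intro x x' hx _
    rw [mask_eq_mask]
    intro s hs
    simpa [hs] using congrFun hx s
  · intro x x' hx
    rw [mask_eq_mask] at hx
    funext s
    by_cases hs : s = t
    · simp [hs]
    · simpa [hs] using hx s hs
  · intro x x' hx _
    rw [mask_eq_mask]
    intro s hs
    simpa [hs] using congrFun hx s
  · intro x x' hx _
    rw [Prod.mk.injEq, mask_eq_mask]
    refine ⟨by simpa using congrFun hx t, fun s hs => by simpa [hs] using congrFun hx s⟩

/-- In an i.i.d. block, a Markov chain holds between the components of the letter at time `t`, jointly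
with the other letters. -/
theorem Markov.letter {E : Type*} [Fintype E] {r : E → ℝ} (hr : ∀ e, 0 ≤ r e)
    (X : E → α) (C : E → γ) {l : ℕ} (t : Fin l) :
    Markov (MultiterminalSC.iidWeight r l) (fun x => X (x t)) (fun x => C (x t))
      (fun x => mask (· ≠ t) x) := by
  classical
  -- At every time one of the outer variables is constant: `Y` at `t`, `X` elsewhere.
  have h1 := Markov.iidWeight (r := r) (l := l)
    (X := fun s e => if s = t then some (X e) else none)
    (C := fun s e => if s = t then some (C e) else none)
    (Y := fun s e => if s = t then none else some e) fun s => by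
      by_cases hs : s = t
      · simp only [if_pos hs]
        exact markov_of_determines fun _ _ _ => rfl
      · simp only [if_neg hs]
        exact (markov_of_determines fun _ _ _ => rfl).symm
  refine h1.mono (iidWeight_nonneg hr) ?_ ?_ ?_ ?_
  · intro x x' hx _
    simpa using congrFun hx t
  · intro x x' hx
    funext s
    by_cases hs : s = t
    · simp [hs, hx]
    · simp [hs]
  · intro x x' hx _
    simpa using congrFun hx t
  · intro x x' hx _
    rw [mask_eq_mask]
    intro s hs
    simpa [hs] using congrFun hx s

end Markov

/-! ### The auxiliary variables of a block code and their Markov conditions. -/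

section Block

variable {n J : ℕ} {A S : Type} {Y : Fin n → Type} {V : Fin J → Type*} {ζ : Type} {l : ℕ}
  {M : Fin n → ℕ}

/-- The auxiliary variable of encoder `i` at time `t`: its message, the past of `Z`, and the side
information at the other times. -/
noncomputable def blockU (f : (i : Fin n) → (Fin l → Y i) → Fin (M i)) (i : Fin n)
    (ω : Fin l × (Fin l → ζ × Sym A Y S)) :
    Fin (M i) × (Fin l → Option ζ) × (Fin l → Option S) :=
  (f i fun s => (ω.2 s).2.2.1 i, mask (· < ω.1) fun s => (ω.2 s).1,
    mask (· ≠ ω.1) fun s => (ω.2 s).2.2.2)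

/-- The values of `Z` and of the side information at the times other than `t`. -/
noncomputable def blockW (ω : Fin l × (Fin l → ζ × Sym A Y S)) : Fin l → Option (ζ × S) :=
  mask (· ≠ ω.1) fun s => ((ω.2 s).1, (ω.2 s).2.2.2)

/-- The reproductions at time `t`. -/
def blockV (f : (i : Fin n) → (Fin l → Y i) → Fin (M i))
    (g : (K : Msgs n) → (j : Fin J) → (Fin l → S) → ((i : K.1) → Fin (M i)) → Fin l → V j)
    (ω : Fin l × (Fin l → ζ × Sym A Y S)) : Msgs n → (j : Fin J) → V j :=
  fun K j => g K j (fun s => (ω.2 s).2.2.2) (fun i => f i fun s => (ω.2 s).2.2.1 i) ω.1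

variable {f : (i : Fin n) → (Fin l → Y i) → Fin (M i)}
  {g : (K : Msgs n) → (j : Fin J) → (Fin l → S) → ((i : K.1) → Fin (M i)) → Fin l → V j}

/-- Any single `U_i` with `i ∈ K` supplies the side information off time `t`, so with `S_t` the
decoder input is complete. This is where `K` must be nonempty. -/
theorem blockV_eq {K : Msgs n} {ω ω' : Fin l × (Fin l → ζ × Sym A Y S)}
    (hU : ∀ i ∈ K.1, blockU f i ω = blockU f i ω') (hS : (ω.2 ω.1).2.2.2 = (ω'.2 ω'.1).2.2.2)
    (hT : ω.1 = ω'.1) : blockV f g ω K = blockV f g ω' K := by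
  obtain ⟨t, x⟩ := ω
  obtain ⟨t', x'⟩ := ω'
  obtain rfl : t = t' := hT
  have hs : (fun s => (x s).2.2.2) = fun s => (x' s).2.2.2 := by
    obtain ⟨i, hi⟩ := K.2
    have h1 := hU i hi
    simp only [blockU, Prod.mk.injEq, mask_eq_mask] at h1
    funext s
    by_cases hs : s = t
    · rw [hs]; exact hS
    · exact h1.2.2 s hs
  have hf : (fun i : K.1 => f i fun s => (x s).2.2.1 i) =
      fun i : K.1 => f i fun s => (x' s).2.2.1 i := by
    funext i
    have h1 := hU i i.2
    simp only [blockU, Prod.mk.injEq] at h1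
    exact h1.1
  unfold blockV
  simp only [hs, hf]

variable [Fintype A] [Fintype S] [∀ i, Fintype (Y i)] [Fintype ζ]
  {q : Sym A Y S → ℝ} {r : ζ × Sym A Y S → ℝ}

/-- Given `Z` and `S` off time `t`, the values of `Y_i` there are independent of the other encoders'
values there and of the whole letter at `t`. Besides these, `U_i` needs only `Y_i` at time `t`,
which is moved into the conditioning, and parts of `W`. -/
theorem markov_blockU (hψ : IsPsi q r) (f : (i : Fin n) → (Fin l → Y i) → Fin (M i)) (i : Fin n) :
    Markov (mixWeight (iidWeight r l) l) (blockU f i)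
      (fun ω => ((ω.2 ω.1).2.2.1 i, blockW ω, ω.1))
      (fun ω => ((ω.2 ω.1).2.1, (fun k : {k // k ≠ i} => (ω.2 ω.1).2.2.1 k), (ω.2 ω.1).2.2.2,
        (fun k : {k // k ≠ i} => blockU f k ω))) := by
  refine Markov.mixWeight (fun ω ω' h => congrArg (·.2.2) h) fun t => ?_
  have hr := hψ.mem_simplex.1
  refine ((hψ.condIndep.markov hr i).block hr t).mono (iidWeight_nonneg hr) ?_ ?_ ?_ ?_
  · intro x x' hX hC
    simp only [blockU, blockW, Prod.mk.injEq, mask_eq_mask] at hX hC ⊢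
    refine ⟨congrArg _ (funext fun s => ?_), fun s hs => (hC.2.1 s hs.ne).1,
      fun s hs => (hC.2.1 s hs).2⟩
    by_cases hs : s = t
    · rw [hs, hC.1]
    · exact hX s hs
  · intro x x' hC
    simp only [blockW, Prod.mk.injEq, mask_eq_mask] at hC ⊢
    exact hC.2.1
  · intro x x' hC hY
    simp only [blockW, Prod.mk.injEq, mask_eq_mask] at hC hY ⊢
    exact ⟨by rw [hY.1], hC, trivial⟩
  · intro x x' hY hC
    simp only [blockU, blockW, Prod.mk.injEq, mask_eq_mask] at hY hC ⊢
    refine ⟨by rw [hY.1], by rw [hY.1], by rw [hY.1], funext fun k => ?_⟩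
    simp only [Prod.mk.injEq, mask_eq_mask]
    refine ⟨congrArg _ (funext fun s => ?_), fun s hs => (hC.2.1 s hs.ne).1,
      fun s hs => (hC.2.1 s hs).2⟩
    by_cases hs : s = t
    · rw [hs, hY.1]
    · exact congrFun (hY.2 s hs) k

theorem indep_blockW (hψ : IsPsi q r) (hl : 0 < l) :
    Indep (mixWeight (iidWeight r l) l) (fun ω => (blockW ω, ω.1)) (fun ω => (ω.2 ω.1).2) := by
  have hr := hψ.mem_simplex.1
  have hs := sum_iidWeight (l := l) hψ.mem_simplex.2
  rintro ⟨w, t⟩ y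
  rw [law_mixWeight_of_const (X := fun ω : Fin l × (Fin l → ζ × Sym A Y S) => (ω.2 ω.1).2) hl
      fun t => law_iidWeight_apply hψ.mem_simplex.2 (fun e => e.2) t y,
    law_mixWeight_of_time (X := fun ω : Fin l × (Fin l → ζ × Sym A Y S) => (blockW ω, ω.1)) (t := t)
      fun ω hω => congrArg (·.2) hω,
    law_mixWeight_of_time (t := t) fun ω hω => congrArg (·.1.2) hω, mul_assoc]
  congr 1
  -- With a constant middle variable, `Markov.block` becomes independence of `W` from the letter at
  -- time `t`.
  have h1 : Markov r (fun e => (e.1, e.2.2.2)) (fun _ => ()) (fun _ => ()) :=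
    markov_of_determines fun _ _ _ => rfl
  have h2 := (h1.block hr t).mono (iidWeight_nonneg hr)
    (X' := fun x => (blockW (t, x), t)) (C' := fun _ => ()) (Y' := fun x => (x t).2)
    (fun x x' h _ => by simp only [blockW]; rw [h]) (fun x x' _ => by simp)
    (fun _ _ _ _ => rfl) (fun x x' h _ => by rw [(Prod.mk.inj h).1])
  have h3 := h2 (w, t) () y
  rw [law_of_forall (X := fun _ => ()) hs fun _ => rfl, mul_one] at h3
  rw [← law_iidWeight_apply (l := l) hψ.mem_simplex.2 (fun e => e.2) t y]
  refine ((law_congr fun x => ?_).trans h3).trans ?_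
  · simp
  · congr 1 <;> exact law_congr fun x => by simp

/-- Given the source symbol at time `t`, the value of `Z` there is independent of all other letters,
and these together with that symbol determine `U`, `V` and `W`. The conditioning does not reveal
`T`, so passing to the mixture uses that the law of `(Z_t, X_t)` is the same for all `t`. -/
theorem markov_block_coupling (hψ : IsPsi q r) (hl : 0 < l)
    (f : (i : Fin n) → (Fin l → Y i) → Fin (M i))
    (g : (K : Msgs n) → (j : Fin J) → (Fin l → S) → ((i : K.1) → Fin (M i)) → Fin l → V j) :
    Markov (mixWeight (iidWeight r l) l) (fun ω => (ω.2 ω.1).1) (fun ω => (ω.2 ω.1).2)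
      (fun ω => ((fun i => blockU f i ω), blockV f g ω, blockW ω, ω.1)) := by
  have hr := hψ.mem_simplex.1
  refine Markov.mixWeight_of_stationary hl (fun ω ω' h => congrArg (·.2.2.2) h) (fun t => ?_)
    (fun t z y => law_iidWeight_apply hψ.mem_simplex.2 (fun e => (e.1, e.2)) t (z, y))
    (fun t y => law_iidWeight_apply hψ.mem_simplex.2 (fun e => e.2) t y)
  refine (Markov.letter hr (fun e => e.1) (fun e => e.2) t).mono (iidWeight_nonneg hr)
    (fun _ _ h _ => h) (fun _ _ h => h) (fun _ _ h _ => h) ?_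
  intro x x' hY hC
  rw [mask_eq_mask] at hY
  have hX : ∀ s, (x s).2 = (x' s).2 := by
    intro s
    by_cases hs : s = t
    · rw [hs]; exact hC
    · rw [hY s hs]
  refine Prod.ext (funext fun i => ?_) (Prod.ext ?_ (Prod.ext ?_ rfl))
  · simp only [blockU, hX, Prod.mk.injEq, mask_eq_mask, true_and, and_true]
    exact fun s hs => by rw [hY s hs.ne]
  · funext K j
    simp only [blockV, hX]
  · simp only [blockW, hX, mask_eq_mask, Prod.mk.injEq, and_true]
    exact fun s hs => by rw [hY s hs]

/-- The auxiliary variables of a block code, at a time chosen uniformly at random. -/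
noncomputable def blockAux (hψ : IsPsi q r) (hl : 0 < l)
    (f : (i : Fin n) → (Fin l → Y i) → Fin (M i))
    (g : (K : Msgs n) → (j : Fin J) → (Fin l → S) → ((i : K.1) → Fin (M i)) → Fin l → V j) :
    Aux r (Msgs n → (j : Fin J) → V j) where
  Ω := Fin l × (Fin l → ζ × Sym A Y S)
  p := mixWeight (iidWeight r l) l
  mem_simplex := ⟨mixWeight_nonneg (iidWeight_nonneg hψ.mem_simplex.1),
    sum_mixWeight hl (sum_iidWeight hψ.mem_simplex.2)⟩
  Z ω := (ω.2 ω.1).1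
  X ω := (ω.2 ω.1).2
  U := blockU f
  V := blockV f g
  W := blockW
  T ω := ω.1
  law_eq zx := law_mixWeight_of_const hl fun t =>
    (law_iidWeight_apply hψ.mem_simplex.2 (fun e => (e.1, e.2)) t zx).trans
      (law_of_injective (X := fun e : ζ × Sym A Y S => (e.1, e.2)) (fun _ _ h => h) zx)
  indep := indep_blockW hψ hl
  markov_U := markov_blockU hψ f
  markov_V := markov_of_determines fun ω ω' h => by
    simp only [Prod.mk.injEq] at h
    exact funext fun K => blockV_eq (fun i _ => congrFun h.1 i) h.2.1 h.2.2
  coupling := markov_block_coupling hψ hl f g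

theorem subsetMarkov_blockAux (hψ : IsPsi q r) (hl : 0 < l)
    (f : (i : Fin n) → (Fin l → Y i) → Fin (M i))
    (g : (K : Msgs n) → (j : Fin J) → (Fin l → S) → ((i : K.1) → Fin (M i)) → Fin l → V j) :
    (blockAux hψ hl f g).SubsetMarkov := fun K => markov_of_determines fun ω ω' h => by
  simp only [Prod.mk.injEq] at h
  exact blockV_eq (fun i hi => congrFun h.1 ⟨i, hi⟩) h.2.1 h.2.2

/-- The uniform time produces the average over the block; the code does not see `Z`, so summing it
out replaces `r` by `q`. -/
theorem distortion_blockAux (hψ : IsPsi q r) (hl : 0 < l)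
    (f : (i : Fin n) → (Fin l → Y i) → Fin (M i))
    (g : (K : Msgs n) → (j : Fin J) → (Fin l → S) → ((i : K.1) → Fin (M i)) → Fin l → V j)
    (K : Msgs n) (j : Fin J) (d : Sym A Y S → V j → ℝ≥0) :
    (blockAux hψ hl f g).distortion d (fun ω => (blockAux hψ hl f g).V ω K j) =
      blockDistortion q l d
        (fun x => g K j (fun t => (x t).2.2) (fun i => f i (fun t => (x t).2.1 i))) := by
  classical
  have hq : ∀ y, law r (fun e => e.2) y = q y := by
    intro y
    rw [law_eq_sum _ (fun e => e.1), ← hψ.marginal]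
    exact Finset.sum_congr rfl fun z _ =>
      law_of_injective (X := fun e : ζ × Sym A Y S => (e.2, e.1))
        (fun e e' h => Prod.ext (congrArg (·.2) h) (congrArg (·.1) h)) (z, y)
  have h1 : blockDistortion q l d
      (fun x => g K j (fun t => (x t).2.2) (fun i => f i (fun t => (x t).2.1 i))) =
      ∑ x, iidWeight r l x * (1 / (l : ℝ) * ∑ t, (d (x t).2
        (g K j (fun t => (x t).2.2.2) (fun i => f i (fun t => (x t).2.2.1 i)) t) : ℝ)) := by
    rw [blockDistortion, sum_mul_comp_eq_sum_law (p := iidWeight r l) (fun x t => (x t).2)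
      fun y => 1 / (l : ℝ) * ∑ t, (d (y t)
        (g K j (fun t => (y t).2.2) (fun i => f i (fun t => (y t).2.1 i)) t) : ℝ)]
    refine Finset.sum_congr rfl fun y _ => ?_
    rw [law_iidWeight (r := r) (fun _ (e : ζ × Sym A Y S) => e.2) y]
    simp only [hq]
  rw [h1]
  change ∑ ω : Fin l × (Fin l → ζ × Sym A Y S), _ = _
  rw [Fintype.sum_prod_type, Finset.sum_comm]
  refine Finset.sum_congr rfl fun x _ => ?_
  rw [Finset.mul_sum, Finset.mul_sum]
  refine Finset.sum_congr rfl fun t _ => ?_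
  change 1 / (l : ℝ) * iidWeight r l x * (d (x t).2
    (g K j (fun t => (x t).2.2.2) (fun i => f i (fun t => (x t).2.2.1 i)) t) : ℝ) = _
  ring

end Block

/-! ### The sum-rate bounds. -/

section Rate

variable {n : ℕ} {A S : Type} {Y : Fin n → Type} {ζ : Type} {l : ℕ} {M : Fin n → ℕ}

/-- The messages in `K`. -/
def blockMsg (f : (i : Fin n) → (Fin l → Y i) → Fin (M i)) (K : Finset (Fin n))
    (x : Fin l → ζ × Sym A Y S) : (i : K) → Fin (M i) :=
  fun i => f i fun s => (x s).2.2.1 i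

/-- The block of side information. -/
def blockS (x : Fin l → ζ × Sym A Y S) : Fin l → S :=
  fun s => (x s).2.2.2

/-- The block of `Z` and of the side information. -/
def blockZS (x : Fin l → ζ × Sym A Y S) : Fin l → ζ × S :=
  fun s => ((x s).1, (x s).2.2.2)

variable [Fintype A] [Fintype S] [∀ i, Fintype (Y i)] [Fintype ζ]
  {q : Sym A Y S → ℝ} {r : ζ × Sym A Y S → ℝ}

/-- The chain rule for `H(Z^l | U_K, S^l)`. -/
theorem sum_condEntropy_blockU (hr : ∀ e, 0 ≤ r e)
    (f : (i : Fin n) → (Fin l → Y i) → Fin (M i)) (K : Finset (Fin n)) :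
    ∑ t, condEntropy (iidWeight r l) (fun x => (x t).1)
        (fun x => ((fun i : K => blockU f i (t, x)), (x t).2.2.2)) =
      entropy (iidWeight r l) (fun x => (blockMsg f K x, blockZS x)) -
        entropy (iidWeight r l) (fun x => (blockMsg f K x, blockS x)) := by
  -- An empty `U_K` carries neither the past of `Z` nor the other side information, so the
  -- telescoping below is unavailable; independence of the letters replaces it.
  rcases K.eq_empty_or_nonempty with rfl | ⟨k, hk⟩
  · have h1 := (condIndepFamily_letters (r := r) (l := l)
      (fun e : ζ × Sym A Y S => (e.1, e.2.2.2)) fun _ => ()).condEntropy_eq_sum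
        (iidWeight_nonneg hr)
    have h2 := (condIndepFamily_letters (r := r) (l := l)
      (fun e : ζ × Sym A Y S => e.2.2.2) fun _ => ()).condEntropy_eq_sum (iidWeight_nonneg hr)
    have h3 : entropy (iidWeight r l) (fun x => (blockMsg f ∅ x, blockZS x)) =
        entropy (iidWeight r l) (fun x => ((fun t => ((x t).1, (x t).2.2.2)), fun _ : Fin l => ())) :=
      entropy_congr fun x x' => by simp [blockMsg, blockZS, funext_iff]
    have h4 : entropy (iidWeight r l) (fun x => (blockMsg f ∅ x, blockS x)) =
        entropy (iidWeight r l) (fun x => ((fun t => (x t).2.2.2), fun _ : Fin l => ())) :=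
      entropy_congr fun x x' => by simp [blockMsg, blockS, funext_iff]
    rw [h3, h4]
    have h5 : ∀ a b c : ℝ, a - b = (a - c) - (b - c) := fun a b c => by ring
    -- Subtracting the entropy of a constant from both terms turns them into the conditional
    -- entropies of `h1` and `h2`.
    rw [h5 _ _ (entropy (iidWeight r l) fun _ => fun _ : Fin l => ())]
    refine Eq.trans ?_ (congrArg₂ (· - ·) h1 h2).symm
    rw [← Finset.sum_sub_distrib]
    refine Finset.sum_congr rfl fun t _ => ?_
    simp only [condEntropy]
    rw [← h5]
    congr 1
    · exact entropy_congr fun x x' => by simp [funext_iff]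
    · exact entropy_congr fun x x' => by simp [funext_iff]
  · set F : ℕ → ℝ := fun m => entropy (iidWeight r l) fun x : Fin l → ζ × Sym A Y S =>
      (blockMsg f K x, mask (fun s : Fin l => (s : ℕ) < m) (fun s => (x s).1), blockS x) with hF
    have h1 : entropy (iidWeight r l) (fun x => (blockMsg f K x, blockZS x)) = F l :=
      entropy_congr fun x x' => by
        simp only [Prod.mk.injEq, mask_eq_mask]
        simp [blockZS, blockS, funext_iff, forall_and]
    have h2 : entropy (iidWeight r l) (fun x => (blockMsg f K x, blockS x)) = F 0 :=
      entropy_congr fun x x' => by simp [Prod.mk.injEq, mask_eq_mask]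
    rw [h1, h2, ← sum_fin_sub_succ]
    refine Finset.sum_congr rfl fun t _ => ?_
    -- For nonempty `K`, `(U_K, S_t)` carries the same information as `(M_K, Z^{t-1}, S^l)`, the
    -- conditioning of the `t`-th chain-rule term.
    have h3 : ∀ x x' : Fin l → ζ × Sym A Y S,
        ((fun i : K => blockU f i (t, x)), (x t).2.2.2) =
          ((fun i : K => blockU f i (t, x')), (x' t).2.2.2) ↔
        (blockMsg f K x, mask (fun s : Fin l => (s : ℕ) < t) (fun s => (x s).1), blockS x) =
          (blockMsg f K x', mask (fun s : Fin l => (s : ℕ) < t) (fun s => (x' s).1), blockS x') := by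
      intro x x'
      simp only [Prod.mk.injEq, mask_eq_mask]
      constructor
      · rintro ⟨h, hS⟩
        replace h := fun i => congrFun h i
        simp only [blockU, Prod.mk.injEq, mask_eq_mask] at h
        refine ⟨funext fun i => (h i).1, (h ⟨k, hk⟩).2.1, funext fun s => ?_⟩
        by_cases hs : s = t
        · rw [hs]; exact hS
        · exact (h ⟨k, hk⟩).2.2 s hs
      · rintro ⟨hm, hZ, hS⟩
        refine ⟨funext fun i => ?_, congrFun hS t⟩
        simp only [blockU, Prod.mk.injEq, mask_eq_mask]
        exact ⟨congrFun hm i, hZ, fun s _ => congrFun hS s⟩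
    rw [condEntropy]
    congr 1
    · refine entropy_congr fun x x' => ?_
      rw [Prod.mk.injEq, h3]
      simp only [Prod.mk.injEq, mask_eq_mask]
      constructor
      · rintro ⟨hZ, hm, hZ', hS⟩
        refine ⟨hm, fun s hs => ?_, hS⟩
        rcases Nat.lt_succ_iff_lt_or_eq.1 hs with h4 | h4
        · exact hZ' s h4
        · rwa [Fin.ext h4]
      · rintro ⟨hm, hZ, hS⟩
        exact ⟨hZ t (by omega), hm, fun s hs => hZ s (by omega), hS⟩
    · exact entropy_congr h3

/-- The single-letter bound on `H(message of i | Z^l, S^l)`. -/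
theorem sum_condMutualInfo_blockU_le (hr : r ∈ stdSimplex ℝ (ζ × Sym A Y S))
    (f : (i : Fin n) → (Fin l → Y i) → Fin (M i)) (i : Fin n) :
    ∑ t, condMutualInfo (iidWeight r l) (fun x => (x t).2.2.1 i) (fun x => blockU f i (t, x))
        (fun x => ((x t).1, (x t).2.2.2, blockW (t, x), t)) ≤
      condEntropy (iidWeight r l) (fun x => f i fun s => (x s).2.2.1 i) blockZS := by
  have hp : ∀ x, 0 ≤ iidWeight r l x := iidWeight_nonneg hr.1
  -- `W` supplies all times other than `t`, so the conditioning is on the whole block `(Z^l, S^l)`.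
  have hW : ∀ (t : Fin l) (x x' : Fin l → ζ × Sym A Y S),
      ((x t).1, (x t).2.2.2, blockW (t, x), t) = ((x' t).1, (x' t).2.2.2, blockW (t, x'), t) ↔
        blockZS x = blockZS x' := by
    intro t x x'
    rw [funext_iff]
    simp only [blockZS, blockW, Prod.mk.injEq, mask_eq_mask, and_true]
    constructor
    · rintro ⟨h1, h2, h3⟩ s
      by_cases hs : s = t
      · subst hs; exact ⟨h1, h2⟩
      · exact h3 s hs
    · exact fun h => ⟨(h t).1, (h t).2, fun s _ => h s⟩
  have h1 : ∀ t, condMutualInfo (iidWeight r l) (fun x => (x t).2.2.1 i)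
      (fun x => blockU f i (t, x)) (fun x => ((x t).1, (x t).2.2.2, blockW (t, x), t)) =
      condEntropy (iidWeight r l) (fun x => (x t).2.2.1 i) blockZS -
      condEntropy (iidWeight r l) (fun x => (x t).2.2.1 i)
        (fun x => ((f i fun s => (x s).2.2.1 i), blockZS x)) := by
    intro t
    rw [condMutualInfo]
    congr 1
    · exact condEntropy_congr _ (hW t)
    · refine condEntropy_congr _ fun x x' => ?_
      rw [Prod.mk.injEq, hW, Prod.mk.injEq (f i fun s => (x s).2.2.1 i)]
      refine and_congr_left fun h => ?_
      simp only [blockZS, funext_iff, Prod.mk.injEq] at h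
      simp only [blockU, Prod.mk.injEq, mask_eq_mask]
      exact ⟨fun h => h.1, fun h' => ⟨h', fun s _ => (h s).1, fun s _ => (h s).2⟩⟩
  simp only [h1, Finset.sum_sub_distrib]
  -- The unconditioned-on-message terms add up exactly, by independence over time; those given the
  -- message are only subadditive, which gives the inequality.
  have h2 := (condIndepFamily_letters (r := r) (l := l) (fun e : ζ × Sym A Y S => e.2.2.1 i)
    (fun e => (e.1, e.2.2.2))).condEntropy_eq_sum hp
  have h3 := condEntropy_le_sum hp (sum_iidWeight hr.2)
    (fun (t : Fin l) (x : Fin l → ζ × Sym A Y S) => (x t).2.2.1 i)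
    (fun x => ((f i fun s => (x s).2.2.1 i), blockZS x))
  -- The message is a function of `Y_i^l`.
  have h4 : entropy (iidWeight r l) (fun x => ((fun t => (x t).2.2.1 i),
        (f i fun s => (x s).2.2.1 i), blockZS x)) =
      entropy (iidWeight r l) (fun x => ((fun t => (x t).2.2.1 i), blockZS x)) :=
    entropy_congr fun x x' => by
      simp only [Prod.mk.injEq]
      exact ⟨fun h => ⟨h.1, h.2.2⟩, fun h => ⟨h.1, by rw [h.1], h.2⟩⟩
  change condEntropy (iidWeight r l) (fun x (t : Fin l) => (x t).2.2.1 i) blockZS =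
    ∑ t, condEntropy (iidWeight r l) (fun x => (x t).2.2.1 i) blockZS at h2
  rw [← h2]
  simp only [condEntropy] at h3 ⊢
  rw [h4] at h3
  linarith

/-- The defining property of `ψ` passes to blocks and then to the messages, each a function of its
own `Y_i^l`. -/
theorem condEntropy_blockMsg (hψ : IsPsi q r) (f : (i : Fin n) → (Fin l → Y i) → Fin (M i))
    (K : Finset (Fin n)) :
    condEntropy (iidWeight r l) (blockMsg f K) blockZS =
      ∑ i ∈ K, condEntropy (iidWeight r l) (fun x => f i fun s => (x s).2.2.1 i) blockZS := by
  classical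
  exact ((hψ.condIndep.iidWeight (l := l)).comp f).condEntropy_subset
    (iidWeight_nonneg hψ.mem_simplex.1) K

theorem entropy_blockMsg_le (hr : r ∈ stdSimplex ℝ (ζ × Sym A Y S))
    (f : (i : Fin n) → (Fin l → Y i) → Fin (M i)) (K : Finset (Fin n)) :
    entropy (iidWeight r l) (blockMsg f K) ≤ ∑ i ∈ K, Real.logb 2 (M i) := by
  have h := entropy_le_logb_card (iidWeight_nonneg (l := l) hr.1) (sum_iidWeight hr.2)
    (blockMsg f K)
  refine h.trans_eq ?_
  -- Total weight 1 forces some block to exist, and its messages show that no message set is empty.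
  have hM : ∀ i, (M i : ℝ) ≠ 0 := by
    intro i hi
    have hx : IsEmpty (Fin l → ζ × Sym A Y S) := ⟨fun x => by
      have h0 := (f i fun s => (x s).2.2.1 i).pos
      exact h0.ne' (Nat.cast_eq_zero.1 hi)⟩
    have := sum_iidWeight (l := l) hr.2
    simp at this
  rw [Fintype.card_pi, Nat.cast_prod, Real.logb_prod _ _ fun i _ => by simpa using hM i]
  simp only [Fintype.card_fin]
  exact Finset.sum_coe_sort K fun i => Real.logb 2 (M i)

/-- The left side is `H(M_K | M_{K₁}, S^l)`, at most `H(M_K)`. The cases `K₁ = ∅` and `K₁ = Kᶜ`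
serve the two terms of the maximum. -/
theorem entropy_blockMsg_sub_le (hr : r ∈ stdSimplex ℝ (ζ × Sym A Y S))
    (f : (i : Fin n) → (Fin l → Y i) → Fin (M i)) {K K₁ K₂ : Finset (Fin n)} (h : K ∪ K₁ = K₂) :
    entropy (iidWeight r l) (fun x => (blockMsg f K₂ x, blockS x)) -
      entropy (iidWeight r l) (fun x => (blockMsg f K₁ x, blockS x)) ≤
        ∑ i ∈ K, Real.logb 2 (M i) := by
  have h1 := entropy_pair_le (iidWeight_nonneg (l := l) hr.1) (sum_iidWeight hr.2)
    (blockMsg f K) (fun x => (blockMsg f K₁ x, blockS x))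
  have h2 : entropy (iidWeight r l) (fun x => (blockMsg f K₂ x, blockS x)) =
      entropy (iidWeight r l) (fun x => (blockMsg f K x, blockMsg f K₁ x, blockS x)) := by
    refine entropy_congr fun x x' => ?_
    subst h
    simp only [Prod.mk.injEq, funext_iff, blockMsg, Subtype.forall, Finset.mem_union, or_imp,
      forall_and, and_assoc]
  have h3 := entropy_blockMsg_le hr f K
  linarith

variable {J : ℕ} {V : Fin J → Type*}

/-- This is `I(Z^l; M_K | S^l) / l`: the chain rule is applied with the empty set and with `K`. -/
theorem infoZ_blockAux (hψ : IsPsi q r) (hl : 0 < l)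
    (f : (i : Fin n) → (Fin l → Y i) → Fin (M i))
    (g : (K : Msgs n) → (j : Fin J) → (Fin l → S) → ((i : K.1) → Fin (M i)) → Fin l → V j)
    (K : Finset (Fin n)) :
    (blockAux hψ hl f g).infoZ K = 1 / (l : ℝ) *
      ((entropy (iidWeight r l) (fun x => (blockMsg f ∅ x, blockZS x)) -
        entropy (iidWeight r l) (fun x => (blockMsg f ∅ x, blockS x))) -
      (entropy (iidWeight r l) (fun x => (blockMsg f K x, blockZS x)) -
        entropy (iidWeight r l) (fun x => (blockMsg f K x, blockS x)))) := by
  have hr := hψ.mem_simplex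
  rw [← sum_condEntropy_blockU hr.1, ← sum_condEntropy_blockU hr.1, ← Finset.sum_sub_distrib]
  refine (condMutualInfo_mixWeight hl (iidWeight_nonneg hr.1) (sum_iidWeight hr.2) _ _
    fun ω ω' h => congrArg (·.2) h).trans ?_
  congr 1
  refine Finset.sum_congr rfl fun t _ => ?_
  rw [condMutualInfo]
  congr 1
  · exact condEntropy_congr _ fun x x' => by simp [blockAux, funext_iff]
  · refine condEntropy_congr _ fun x x' => ?_
    change ((fun i : K => blockU f i (t, x)), ((x t).2.2.2, t)) =
      ((fun i : K => blockU f i (t, x')), ((x' t).2.2.2, t)) ↔ _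
    simp

/-- This is `I(Z^l; M_K | M_{Kᶜ}, S^l) / l`: the chain rule is applied with `Kᶜ` and, as `U_K` and
`U_{Kᶜ}` make up all of `U`, with the full set. -/
theorem infoZCompl_blockAux (hψ : IsPsi q r) (hl : 0 < l)
    (f : (i : Fin n) → (Fin l → Y i) → Fin (M i))
    (g : (K : Msgs n) → (j : Fin J) → (Fin l → S) → ((i : K.1) → Fin (M i)) → Fin l → V j)
    (K : Finset (Fin n)) :
    (blockAux hψ hl f g).infoZCompl K = 1 / (l : ℝ) *
      ((entropy (iidWeight r l) (fun x => (blockMsg f Kᶜ x, blockZS x)) -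
        entropy (iidWeight r l) (fun x => (blockMsg f Kᶜ x, blockS x))) -
      (entropy (iidWeight r l) (fun x => (blockMsg f Finset.univ x, blockZS x)) -
        entropy (iidWeight r l) (fun x => (blockMsg f Finset.univ x, blockS x)))) := by
  have hr := hψ.mem_simplex
  rw [← sum_condEntropy_blockU hr.1, ← sum_condEntropy_blockU hr.1, ← Finset.sum_sub_distrib]
  refine (condMutualInfo_mixWeight hl (iidWeight_nonneg hr.1) (sum_iidWeight hr.2) _ _
    fun ω ω' h => congrArg (·.2.2) h).trans ?_
  congr 1
  refine Finset.sum_congr rfl fun t _ => ?_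
  rw [condMutualInfo]
  congr 1
  · refine condEntropy_congr _ fun x x' => ?_
    change ((fun i : (Kᶜ : Finset (Fin n)) => blockU f i (t, x)), ((x t).2.2.2, t)) =
      ((fun i : (Kᶜ : Finset (Fin n)) => blockU f i (t, x')), ((x' t).2.2.2, t)) ↔ _
    simp
  · refine condEntropy_congr _ fun x x' => ?_
    simp only [blockAux, Aux.UK, Prod.mk.injEq, and_true, ← and_assoc, funext_iff, Subtype.forall]
    refine and_congr_left fun _ => ⟨fun h i _ => ?_, fun h => ⟨fun i _ => h i (Finset.mem_univ i),
      fun i _ => h i (Finset.mem_univ i)⟩⟩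
    by_cases hi : i ∈ K
    · exact h.1 i hi
    · exact h.2 i (Finset.mem_compl.2 hi)

theorem infoY_blockAux_le (hψ : IsPsi q r) (hl : 0 < l)
    (f : (i : Fin n) → (Fin l → Y i) → Fin (M i))
    (g : (K : Msgs n) → (j : Fin J) → (Fin l → S) → ((i : K.1) → Fin (M i)) → Fin l → V j)
    (i : Fin n) :
    (blockAux hψ hl f g).infoY i ≤ 1 / (l : ℝ) *
      condEntropy (iidWeight r l) (fun x => f i fun s => (x s).2.2.1 i) blockZS := by
  have hr := hψ.mem_simplex
  refine (condMutualInfo_mixWeight hl (iidWeight_nonneg hr.1) (sum_iidWeight hr.2) _ _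
    fun ω ω' h => congrArg (·.2.2.2) h).trans_le ?_
  exact mul_le_mul_of_nonneg_left (sum_condMutualInfo_blockU_le hr f i) (by positivity)

theorem rate_blockAux (hψ : IsPsi q r) (hl : 0 < l)
    (f : (i : Fin n) → (Fin l → Y i) → Fin (M i))
    (g : (K : Msgs n) → (j : Fin J) → (Fin l → S) → ((i : K.1) → Fin (M i)) → Fin l → V j)
    (K : Finset (Fin n)) :
    max ((blockAux hψ hl f g).infoZ K) ((blockAux hψ hl f g).infoZCompl K) +
        ∑ i ∈ K, (blockAux hψ hl f g).infoY i ≤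
      1 / (l : ℝ) * ∑ i ∈ K, Real.logb 2 (M i) := by
  set h : Fin n → ℝ := fun i =>
    condEntropy (iidWeight r l) (fun x => f i fun s => (x s).2.2.1 i) blockZS with hh
  have hY : ∑ i ∈ K, (blockAux hψ hl f g).infoY i ≤ 1 / (l : ℝ) * ∑ i ∈ K, h i := by
    rw [Finset.mul_sum]
    exact Finset.sum_le_sum fun i _ => infoY_blockAux_le hψ hl f g i
  -- With this, adding the sum of `h i` over `K` cancels every entropy involving `Z`, leaving the
  -- difference bounded by `entropy_blockMsg_sub_le`.
  have hZ : ∀ K, entropy (iidWeight r l) (fun x => (blockMsg f K x, blockZS x)) =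
      entropy (iidWeight r l) blockZS + ∑ i ∈ K, h i := by
    intro K
    rw [← condEntropy_blockMsg hψ, condEntropy]
    ring
  have hl' : (0 : ℝ) ≤ 1 / (l : ℝ) := by positivity
  rw [max_add, max_le_iff]
  constructor
  · rw [infoZ_blockAux]
    refine (add_le_add_right hY _).trans ?_
    rw [← mul_add]
    refine mul_le_mul_of_nonneg_left ?_ hl'
    have := entropy_blockMsg_sub_le hψ.mem_simplex f (Finset.union_empty K)
    rw [hZ, hZ, Finset.sum_empty]
    linarith
  · rw [infoZCompl_blockAux]
    refine (add_le_add_right hY _).trans ?_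
    rw [← mul_add]
    refine mul_le_mul_of_nonneg_left ?_ hl'
    have := entropy_blockMsg_sub_le hψ.mem_simplex f (Finset.union_compl K)
    have := Finset.sum_add_sum_compl K h
    rw [hZ, hZ]
    linarith

end Rate

/-! ### The outer bound and its comparison with Wagner and Anantharam. -/

section Main

variable {n J : ℕ} {A S : Type} {Y : Fin n → Type} {V : Fin J → Type*}
  [Fintype A] [Fintype S] [∀ i, Fintype (Y i)]

theorem achievableRegion_subset_outerRegion (q : Sym A Y S → ℝ)
    (d : Msgs n → (j : Fin J) → Sym A Y S → V j → ℝ≥0) :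
    achievableRegion q d ⊆ outerRegion q d := by
  rintro RD ⟨l, hl, M, f, g, hR, hD⟩ ζ _ r hψ
  refine ⟨blockAux hψ hl f g, subsetMarkov_blockAux hψ hl f g, fun K => ?_, fun k j K hK => ?_⟩
  · refine (rate_blockAux hψ hl f g K).trans ?_
    rw [Finset.mul_sum]
    exact Finset.sum_le_sum fun i _ => hR i
  · rw [distortion_blockAux]
    exact hD k j K hK

/-- Keep only the reproductions from the messages in `N`. -/
def Aux.restrictV {ζ : Type} [Fintype ζ] {r : ζ × Sym A Y S → ℝ}
    (a : Aux r (Msgs n → (j : Fin J) → V j)) (N : Msgs n) : Aux r ((j : Fin J) → V j) where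
  Ω := a.Ω
  p := a.p
  mem_simplex := a.mem_simplex
  Z := a.Z
  X := a.X
  U := a.U
  V ω := a.V ω N
  W := a.W
  T := a.T
  law_eq := a.law_eq
  indep := a.indep
  markov_U := a.markov_U
  markov_V := a.markov_V.mono a.mem_simplex.1 (fun _ _ h _ => h) (fun _ _ h => h)
    (fun _ _ h _ => h) fun _ _ h _ => by rw [h]
  coupling := a.coupling.mono a.mem_simplex.1 (fun _ _ h _ => h) (fun _ _ h => h)
    (fun _ _ h _ => h) fun _ _ h _ => by
      simp only [Prod.mk.injEq] at h ⊢
      exact ⟨h.1, by rw [h.2.1], h.2.2⟩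

/-- Restricting `V` to the component at `N` preserves the Markov chains, and the second term is at
most the maximum. -/
theorem mem_wagnerAnantharamRegion {q : Sym A Y S → ℝ}
    {d : Msgs n → (j : Fin J) → Sym A Y S → V j → ℝ≥0} {RD : RDVec n J}
    (h : RD ∈ outerRegion q d) {k : Fin n} {N : Msgs n} (hN : N.1.card = k + 1) :
    (RD.1, RD.2 k) ∈ wagnerAnantharamRegion q (d N) := by
  intro ζ _ r hψ
  obtain ⟨a, -, hR, hD⟩ := h ζ r hψ
  refine ⟨a.restrictV N, fun K => ?_, fun j => hD k j N hN⟩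
  exact (add_le_add_left (le_max_right _ _) _).trans (hR K)

end Main

end MultiterminalSC

theorem mainTheorem11 {n J : ℕ} {A S : Type} {Y : Fin n → Type} {V : Fin J → Type*}
    [Fintype A] [Fintype S] [∀ i, Fintype (Y i)]
    (q : MultiterminalSC.Sym A Y S → ℝ)
    (hq : q ∈ stdSimplex ℝ (MultiterminalSC.Sym A Y S))
    (d : MultiterminalSC.Msgs n → (j : Fin J) → MultiterminalSC.Sym A Y S → V j → ℝ≥0) :
    MultiterminalSC.achievableRegion q d ⊆ MultiterminalSC.outerRegion q d ∧
    ∀ RD ∈ MultiterminalSC.outerRegion q d, ∀ (k : Fin n) (N : MultiterminalSC.Msgs n),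
      N.1 = Finset.univ → (k : ℕ) + 1 = n →
        (RD.1, RD.2 k) ∈ MultiterminalSC.wagnerAnantharamRegion q (d N) :=
  ⟨MultiterminalSC.achievableRegion_subset_outerRegion q d, fun _ h k N hN hk =>
    MultiterminalSC.mem_wagnerAnantharamRegion h (by rw [hN, Finset.card_univ, Fintype.card_fin, hk])⟩
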